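/- Let $f:\mathbb R\to\mathbb R$ be differentiable, $L$-Lipschitz smooth ($|f'(x)-f'(y)|\le L|x-y|$ for all $x,y$), $\mu$-strongly convex for some $\mu>0$ ($f(y)\ge f(x)+f'(x)(y-x)+\tfrac{\mu}{2}|x-y|^2$ for all $x,y$) and bounded from below. For every $n\in\mathbb N$ let $b_n,c_n\in\mathbb R^n$ be (deterministic) vectors such that $\|b_n\|_\infty,\|b_n\|_1,\|c_n\|_\infty,\|c_n\|_1=\Theta(1)$ as $n\to\infty$, and let $G_n$ be a random $n\times n$ real matrix whose entries are independent standard normal variables. Consider the family of physical design problems $(f,c_n,(A_n,B_n,b_n))$, i.e. of minimizing $f\big(c_n^{\mathrm T}(A_n+\operatorname{diag}(B_n\theta))^{-1}b_n\big)$ over $\theta$, with $A_n:=G_n^{-1}$ and $B_n:=I_n$. Let $\odot$ be the entrywise product of vectors, and $\|\cdot\|_p$ the $l^p$ norm of vectors and the induced $l^p$ norm of matrices. Then $G_n$ is almost surely invertible for every $n$, and: (a) for every $n$ and every $\varepsilon>0$, with probability at least $1-2\exp(-\varepsilon^2/2)$, $\|A_n^{-1}\|_2\le 2\sqrt n+\varepsilon$;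 (b) $\mathrm E\big(\|B_n^{\mathrm T}(A_n^{-1}b_n\odot A_n^{-\mathrm T}c_n)\|_2^2\big)$ is finite for every $n$ and is $\ge\Omega(n)$ as $n\to\infty$; (c) $\mathrm E\big(|c_n^{\mathrm T}A_n^{-1}b_n|^2\big)$ is finite for every $n$ and is $\le O(1)$ as $n\to\infty$. Moreover, with $\alpha=\gamma=1/2$, the family satisfies the $(\alpha,\gamma)$-asymptotic convergence conditions on average, that is: $f$ is Lipschitz smooth, strongly convex and bounded from below; $A_n$ is almost surely invertible; $\mathrm E\|A_n^{-1}\|_2\le O(n^{\gamma})$; $\|B_n\|_\infty,\|B_n\|_1,\|B_n\|_2\le O(1)$; $\|b_n\|_\infty,\|b_n\|_1\le O(1)$; $\|c_n\|_\infty,\|c_n\|_1\le O(1)$; $\mathrm E\big(\|B_n^{\mathrm T}(A_n^{-1}b_n\odot A_n^{-\mathrm T}c_n)\|_2^2\big)\ge\Omega(n^{\alpha+\gamma})$; and $\mathrm E|c_n^{\mathrm T}A_n^{-1}b_n|\le O(1)$, where all these expectations are finite for every $n$. -/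

import Mathlib

open MeasureTheory ProbabilityTheory Filter Asymptotics
open scoped Matrix NNReal ENNReal

noncomputable section

/-- The `l^p` norm of a real vector. -/
def vecNorm (p : ℝ≥0∞) {n : ℕ} (v : Fin n → ℝ) : ℝ := ‖WithLp.toLp p v‖

/-- The induced `l^p` norm `sup_{v ≠ 0} ‖M v‖_p / ‖v‖_p` of a real matrix, as the operator norm of
`v ↦ M v` between the `l^p` spaces. -/
def matNorm (p : ℝ≥0∞) [Fact (1 ≤ p)] {n m : ℕ} (M : Matrix (Fin n) (Fin m) ℝ) : ℝ :=
  ‖(Matrix.toLpLin p p M).toContinuousLinearMap‖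

/-- The data `(A, B, b)` of a physical system with state size `n` and parameter size `m`:
physics matrix, selection matrix and source vector. -/
structure PhysicalSystem (n m : ℕ) where
  A : Matrix (Fin n) (Fin n) ℝ
  B : Matrix (Fin n) (Fin m) ℝ
  b : Fin n → ℝ

/-- The vector `Bᵀ (A⁻¹ b ⊙ A⁻ᵀ c)`: up to the factor `-f'(cᵀ A⁻¹ b)`, the gradient at `θ = 0` of
`θ ↦ f (cᵀ (A + diag (B θ))⁻¹ b)`. (`*` on `Fin n → ℝ` is the entrywise product.) -/
def PhysicalSystem.gradVec {n m : ℕ} (φ : PhysicalSystem n m) (c : Fin n → ℝ) : Fin m → ℝ :=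
  φ.Bᵀ *ᵥ ((φ.A⁻¹ *ᵥ φ.b) * ((φ.A⁻¹)ᵀ *ᵥ c))

/-- The number `cᵀ A⁻¹ b`. -/
def PhysicalSystem.overlap {n m : ℕ} (φ : PhysicalSystem n m) (c : Fin n → ℝ) : ℝ :=
  c ⬝ᵥ (φ.A⁻¹ *ᵥ φ.b)

/-- `f` is differentiable, `L`-Lipschitz smooth, `μ`-strongly convex and bounded from below. -/
structure IsAdmissibleCost (f : ℝ → ℝ) (L : ℝ≥0) (μ : ℝ) : Prop where
  differentiable : Differentiable ℝ f
  smooth : LipschitzWith L (deriv f)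
  pos : 0 < μ
  strongConvex : ∀ x y : ℝ, f x + deriv f x * (y - x) + μ * |x - y| ^ 2 / 2 ≤ f y
  bddBelow : BddBelow (Set.range f)

/-- A family of physical design problems `(f, c_n, (A_n, B_n, b_n))`, one for every state size `n`,
with parameter sizes `m n`, a common cost function `f`, and random physics matrices `A_n`. -/
structure RandomDesignFamily (Ω : Type*) (m : ℕ → ℕ) where
  f : ℝ → ℝ
  c : ∀ n, Fin n → ℝ
  A : ∀ n, Ω → Matrix (Fin n) (Fin n) ℝ
  B : ∀ n, Matrix (Fin n) (Fin (m n)) ℝ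
  b : ∀ n, Fin n → ℝ

/-- The physical system of state size `n` at the sample point `ω`. -/
def RandomDesignFamily.sys {Ω : Type*} {m : ℕ → ℕ} (F : RandomDesignFamily Ω m) (n : ℕ) (ω : Ω) :
    PhysicalSystem n (m n) := ⟨F.A n ω, F.B n, F.b n⟩

/-- The family satisfies the `(α, γ)`-asymptotic convergence conditions on average: in each
condition that involves the random physics matrix, namely `‖A_n⁻¹‖₂ ≤ O(n^γ)`,
`‖B_nᵀ (A_n⁻¹ b_n ⊙ A_n⁻ᵀ c_n)‖₂² ≥ Ω(n^(α+γ))` and `|c_nᵀ A_n⁻¹ b_n| ≤ O(1)`, the random quantity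
is integrable and the bound holds for its expectation. -/
structure RandomDesignFamily.ConvergenceConditionsOnAverage {Ω : Type*} [MeasurableSpace Ω]
    {m : ℕ → ℕ} (F : RandomDesignFamily Ω m) (P : Measure Ω) (α γ : ℝ) : Prop where
  cost : ∃ (L : ℝ≥0) (μ : ℝ), IsAdmissibleCost F.f L μ
  invertible : ∀ n, ∀ᵐ ω ∂P, IsUnit (F.A n ω)
  inv_integrable : ∀ n, Integrable (fun ω => matNorm 2 (F.A n ω)⁻¹) P
  inv_bound : (fun n => ∫ ω, matNorm 2 (F.A n ω)⁻¹ ∂P) =O[atTop] fun n : ℕ => (n : ℝ) ^ γ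
  B_infty : (fun n => matNorm ∞ (F.B n)) =O[atTop] fun _ => (1 : ℝ)
  B_one : (fun n => matNorm 1 (F.B n)) =O[atTop] fun _ => (1 : ℝ)
  B_two : (fun n => matNorm 2 (F.B n)) =O[atTop] fun _ => (1 : ℝ)
  b_infty : (fun n => vecNorm ∞ (F.b n)) =O[atTop] fun _ => (1 : ℝ)
  b_one : (fun n => vecNorm 1 (F.b n)) =O[atTop] fun _ => (1 : ℝ)
  c_infty : (fun n => vecNorm ∞ (F.c n)) =O[atTop] fun _ => (1 : ℝ)
  c_one : (fun n => vecNorm 1 (F.c n)) =O[atTop] fun _ => (1 : ℝ)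
  grad_integrable : ∀ n, Integrable (fun ω => vecNorm 2 ((F.sys n ω).gradVec (F.c n)) ^ 2) P
  grad_bound : (fun n : ℕ => (n : ℝ) ^ (α + γ)) =O[atTop]
    fun n => ∫ ω, vecNorm 2 ((F.sys n ω).gradVec (F.c n)) ^ 2 ∂P
  overlap_integrable : ∀ n, Integrable (fun ω => |(F.sys n ω).overlap (F.c n)|) P
  overlap_bound : (fun n => ∫ ω, |(F.sys n ω).overlap (F.c n)| ∂P) =O[atTop] fun _ => (1 : ℝ)

/-- `G` is a random `n × n` matrix whose entries are independent standard normal variables. -/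
structure IsStdGaussianMatrix {Ω : Type*} [MeasurableSpace Ω] (P : Measure Ω) {n : ℕ}
    (G : Ω → Matrix (Fin n) (Fin n) ℝ) : Prop where
  law : ∀ i j, HasLaw (fun ω => G ω i j) (gaussianReal 0 1) P
  indep : iIndepFun (fun (ij : Fin n × Fin n) ω => G ω ij.1 ij.2) P

/-- The family with physics matrices `A_n = G_n⁻¹`, selection matrices `B_n = I_n`, source vectors
`b_n` and overlap vectors `c_n`. -/
def gaussianFamily {Ω : Type*} (f : ℝ → ℝ) (b c : ∀ n, Fin n → ℝ)
    (G : ∀ n, Ω → Matrix (Fin n) (Fin n) ℝ) : RandomDesignFamily Ω (fun n => n) where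
  f := f
  c := c
  A := fun n ω => (G n ω)⁻¹
  B := fun _ => 1
  b := b

end

/-! Almost surely `G_n` is invertible and `A_n⁻¹ = G_n`, so every claim concerns a standard Gaussian
matrix, i.e. the product measure `gaussianPi (Fin n × Fin n)`.

The operator norm is the hard part. It is the supremum of `X = ⟨u, G v⟩` over unit vectors, and `X`
is compared with the simpler process `Y = ⟨u, g⟩ + ⟨v, h⟩`, where `g`, `h` are independent Gaussian
vectors. The covariance of `Y` minus that of `X` is `1 - (1 - ⟨u, u'⟩)(1 - ⟨v, v'⟩)`: equal to `1`
on the diagonal and at most `1` elsewhere. Interpolating between the processes along a rotation,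
with Gaussian integration by parts, compares the moments of `∑ exp (β X)` and `∑ exp (β Y)` of order
`l / β` (`exp_mul_integral_expSum_rpow_le`). As `β → ∞` these moments become exponential moments of
the maximum, and the explicit bound for `Y` gives `E exp (l ‖G‖) ≤ exp (2 l √n + l² / 2)`
(`lintegral_exp_sup_bilin_le`, `lintegral_exp_matNorm_le`). Markov's inequality then yields the tail
bound, and `l = 1` the mean.

The remaining expectations are moments of degree at most four of linear forms in the entries.
Integration by parts evaluates or bounds them through `‖b‖₂` and `‖c‖₂`, which lie between the `l^∞`
and `l^1` norms and are therefore `Θ(1)`. -/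

/-- The standard Gaussian measure on `ι → ℝ`. -/
noncomputable abbrev gaussianPi (ι : Type*) [Fintype ι] : Measure (ι → ℝ) :=
  Measure.pi fun _ => gaussianReal 0 1

/-- The density of the standard Gaussian measure on `ι → ℝ`. -/
noncomputable def gaussianPiDensity {ι : Type*} [Fintype ι] (z : ι → ℝ) : ℝ :=
  ∏ i, gaussianPDFReal 0 1 (z i)

/-! ### Gaussian product measure: integration by parts and integrability -/

section GaussianPi

variable {ι : Type*} [Fintype ι]

lemma gaussianPiDensity_nonneg (z : ι → ℝ) : 0 ≤ gaussianPiDensity z :=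
  Finset.prod_nonneg fun i _ => gaussianPDFReal_nonneg 0 1 (z i)

lemma measurable_gaussianPiDensity : Measurable (gaussianPiDensity : (ι → ℝ) → ℝ) :=
  Finset.measurable_prod _ fun i _ =>
    (measurable_gaussianPDFReal 0 1).comp (measurable_pi_apply i)

lemma gaussianPi_eq_withDensity :
    gaussianPi ι = volume.withDensity fun z => ENNReal.ofReal (gaussianPiDensity z) := by
  refine Measure.pi_eq fun s hs => ?_
  rw [withDensity_apply _ (MeasurableSet.univ_pi hs), volume_pi, Measure.restrict_pi_pi,
    ← ofReal_integral_eq_lintegral_ofReal]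
  · unfold gaussianPiDensity
    rw [integral_fintype_prod_eq_prod (f := fun _ x => gaussianPDFReal 0 1 x),
      ENNReal.ofReal_prod_of_nonneg
        (fun i _ => integral_nonneg fun x => gaussianPDFReal_nonneg 0 1 x)]
    exact Finset.prod_congr rfl fun i _ =>
      (gaussianReal_apply_eq_integral 0 one_ne_zero (s i)).symm
  · exact Integrable.fintype_prod (f := fun _ x => gaussianPDFReal 0 1 x)
      fun i => (integrable_gaussianPDFReal 0 1).restrict
  · exact Eventually.of_forall gaussianPiDensity_nonneg

lemma integrable_gaussianPi_iff {g : (ι → ℝ) → ℝ} :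
    Integrable g (gaussianPi ι) ↔ Integrable fun z => gaussianPiDensity z * g z := by
  rw [gaussianPi_eq_withDensity, integrable_withDensity_iff_integrable_smul'
    measurable_gaussianPiDensity.ennreal_ofReal (by simp)]
  simp [ENNReal.toReal_ofReal, gaussianPiDensity_nonneg]

lemma integral_gaussianPi {g : (ι → ℝ) → ℝ} :
    ∫ z, g z ∂gaussianPi ι = ∫ z, gaussianPiDensity z * g z := by
  rw [gaussianPi_eq_withDensity, integral_withDensity_eq_integral_toReal_smul
    measurable_gaussianPiDensity.ennreal_ofReal (by simp)]
  simp [ENNReal.toReal_ofReal, gaussianPiDensity_nonneg]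

lemma hasLineDerivAt_gaussianPiDensity (z v : ι → ℝ) :
    HasLineDerivAt ℝ gaussianPiDensity (-((v ⬝ᵥ z) * gaussianPiDensity z)) z v := by
  have h (y : ι → ℝ) : gaussianPiDensity y =
      (∏ _i : ι, (√(2 * Real.pi))⁻¹) * Real.exp (-(y ⬝ᵥ y) / 2) := by
    simp only [gaussianPiDensity, gaussianPDFReal, Finset.prod_mul_distrib, ← Real.exp_sum]
    simp [dotProduct, ← Finset.sum_neg_distrib, Finset.sum_div, sq]
  have h1 : HasDerivAt (fun t : ℝ => -((z + t • v) ⬝ᵥ (z + t • v)) / 2) (-(v ⬝ᵥ z)) 0 := by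
    have e : (fun t : ℝ => -((z + t • v) ⬝ᵥ (z + t • v)) / 2) =
        fun t : ℝ => -(z ⬝ᵥ z) / 2 + t * -(v ⬝ᵥ z) + t ^ 2 * (-(v ⬝ᵥ v) / 2) := by
      funext t
      simp only [add_dotProduct, dotProduct_add, smul_dotProduct, dotProduct_smul, smul_eq_mul,
        dotProduct_comm z v]
      ring
    rw [e]
    have := (((hasDerivAt_id (0 : ℝ)).mul_const (-(v ⬝ᵥ z))).const_add (-(z ⬝ᵥ z) / 2)).add
      (((hasDerivAt_id (0 : ℝ)).pow 2).mul_const (-(v ⬝ᵥ v) / 2))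
    exact this.congr_deriv (by simp)
  have h2 := h1.exp.const_mul (∏ _i : ι, (√(2 * Real.pi))⁻¹)
  simp only [zero_smul, add_zero] at h2
  refine (h2.congr_deriv ?_).congr_of_eventuallyEq (Eventually.of_forall fun t => h _)
  rw [h]
  ring

/-- **Gaussian integration by parts** (Stein's identity) in the direction `v`. -/
theorem integral_dotProduct_mul_gaussianPi {g g' : (ι → ℝ) → ℝ} {v : ι → ℝ}
    (hg : ∀ z, HasLineDerivAt ℝ g (g' z) z v) (hgi : Integrable g (gaussianPi ι))
    (hgi' : Integrable g' (gaussianPi ι))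
    (hvg : Integrable (fun z => (v ⬝ᵥ z) * g z) (gaussianPi ι)) :
    ∫ z, (v ⬝ᵥ z) * g z ∂gaussianPi ι = ∫ z, g' z ∂gaussianPi ι := by
  rw [integrable_gaussianPi_iff] at hgi hgi' hvg
  have key := integral_bilinear_hasLineDerivAt_right_eq_neg_left_of_integrable
    (μ := (volume : Measure (ι → ℝ))) (B := ContinuousLinearMap.mul ℝ ℝ) (v := v)
    (f := gaussianPiDensity) (f' := fun z => -((v ⬝ᵥ z) * gaussianPiDensity z))
    (g := g) (g' := g') ?_ hgi' hgi
    (fun z _ => hasLineDerivAt_gaussianPiDensity z v) (fun z _ => hg z)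
  · simp only [ContinuousLinearMap.mul_apply'] at key
    rw [integral_gaussianPi, integral_gaussianPi, key, ← integral_neg]
    congr 1 with z
    ring
  · convert hvg.neg using 2
    simp only [ContinuousLinearMap.mul_apply', Pi.neg_apply]
    ring

/-- `g` grows at most exponentially. -/
def HasExpGrowth (g : (ι → ℝ) → ℝ) : Prop :=
  ∃ C : ℝ, 0 ≤ C ∧ ∀ z, |g z| ≤ C * Real.exp (C * ∑ i, |z i|)

lemma HasExpGrowth.of_abs_le {g h : (ι → ℝ) → ℝ} (hh : HasExpGrowth h)
    (hgh : ∀ z, |g z| ≤ |h z|) : HasExpGrowth g := by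
  obtain ⟨C, hC, H⟩ := hh
  exact ⟨C, hC, fun z => (hgh z).trans (H z)⟩

lemma HasExpGrowth.const (a : ℝ) : HasExpGrowth (fun _ : ι → ℝ => a) := by
  refine ⟨|a|, abs_nonneg a, fun z => le_mul_of_one_le_right (abs_nonneg a) ?_⟩
  exact Real.one_le_exp (by positivity)

lemma HasExpGrowth.add {g h : (ι → ℝ) → ℝ} (hg : HasExpGrowth g) (hh : HasExpGrowth h) :
    HasExpGrowth (fun z => g z + h z) := by
  obtain ⟨C, hC, H⟩ := hg
  obtain ⟨D, hD, K⟩ := hh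
  refine ⟨C + D, by positivity, fun z => (abs_add_le _ _).trans ?_⟩
  rw [add_mul]
  have hs : 0 ≤ ∑ i, |z i| := by positivity
  refine add_le_add ((H z).trans ?_) ((K z).trans ?_)
  · gcongr; linarith
  · gcongr; linarith

lemma HasExpGrowth.mul {g h : (ι → ℝ) → ℝ} (hg : HasExpGrowth g) (hh : HasExpGrowth h) :
    HasExpGrowth (fun z => g z * h z) := by
  obtain ⟨C, hC, H⟩ := hg
  obtain ⟨D, hD, K⟩ := hh
  -- One constant must serve as prefactor and as rate: `C * D` covers the former, `C + D` the
  -- latter.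
  refine ⟨C * D + (C + D), by positivity, fun z => ?_⟩
  have hs : 0 ≤ ∑ i, |z i| := by positivity
  have hCD : 0 ≤ C * D := by positivity
  calc |g z * h z| ≤ (C * Real.exp (C * ∑ i, |z i|)) * (D * Real.exp (D * ∑ i, |z i|)) := by
        rw [abs_mul]
        exact mul_le_mul (H z) (K z) (abs_nonneg _) (by positivity)
    _ = (C * D) * Real.exp ((C + D) * ∑ i, |z i|) := by
        rw [add_mul C D (∑ i, |z i|), Real.exp_add]; ring
    _ ≤ _ := mul_le_mul (by linarith)
        (Real.exp_le_exp.2 (mul_le_mul_of_nonneg_right (by linarith) hs)) (Real.exp_pos _).le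
        (by positivity)

lemma HasExpGrowth.sum {κ : Type*} {s : Finset κ} {g : κ → (ι → ℝ) → ℝ}
    (hg : ∀ k ∈ s, HasExpGrowth (g k)) : HasExpGrowth (fun z => ∑ k ∈ s, g k z) := by
  classical
  induction s using Finset.induction_on with
  | empty => simpa using HasExpGrowth.const (ι := ι) 0
  | insert k s hk ih =>
    simp only [Finset.sum_insert hk]
    exact (hg k (Finset.mem_insert_self k s)).add
      (ih fun l hl => hg l (Finset.mem_insert_of_mem hl))

lemma HasExpGrowth.pow {g : (ι → ℝ) → ℝ} (hg : HasExpGrowth g) (k : ℕ) :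
    HasExpGrowth (fun z => g z ^ k) := by
  induction k with
  | zero => simpa using HasExpGrowth.const (ι := ι) 1
  | succ k ih => simpa only [pow_succ] using ih.mul hg

lemma abs_dotProduct_le_sum_mul_sum (v z : ι → ℝ) :
    |v ⬝ᵥ z| ≤ (∑ i, |v i|) * ∑ i, |z i| := by
  rw [dotProduct, Finset.sum_mul]
  refine (Finset.abs_sum_le_sum_abs _ _).trans (Finset.sum_le_sum fun i hi => ?_)
  rw [abs_mul]
  exact mul_le_mul_of_nonneg_left
    (Finset.single_le_sum (f := fun j => |z j|) (fun j _ => abs_nonneg _) hi) (abs_nonneg _)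

lemma hasExpGrowth_sum_abs : HasExpGrowth (fun z : ι → ℝ => ∑ i, |z i|) := by
  refine ⟨1, zero_le_one, fun z => ?_⟩
  rw [abs_of_nonneg (by positivity), one_mul, one_mul]
  linarith [Real.add_one_le_exp (∑ i, |z i|)]

lemma hasExpGrowth_exp_mul_sum_abs (C : ℝ) :
    HasExpGrowth (fun z : ι → ℝ => Real.exp (C * ∑ i, |z i|)) := by
  refine ⟨1 + |C|, by positivity, fun z => ?_⟩
  have hs : 0 ≤ ∑ i, |z i| := by positivity
  rw [abs_of_pos (Real.exp_pos _)]
  refine le_trans ?_ (le_mul_of_one_le_left (Real.exp_pos _).le (by linarith [abs_nonneg C]))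
  gcongr
  linarith [le_abs_self C]

lemma hasExpGrowth_dotProduct (v : ι → ℝ) : HasExpGrowth (fun z => v ⬝ᵥ z) :=
  ((HasExpGrowth.const (∑ i, |v i|)).mul hasExpGrowth_sum_abs).of_abs_le fun z =>
    (abs_dotProduct_le_sum_mul_sum v z).trans (le_abs_self _)

lemma hasExpGrowth_exp_dotProduct (v : ι → ℝ) :
    HasExpGrowth (fun z => Real.exp (v ⬝ᵥ z)) :=
  (hasExpGrowth_exp_mul_sum_abs (∑ i, |v i|)).of_abs_le fun z => by
    rw [abs_of_pos (Real.exp_pos _), abs_of_pos (Real.exp_pos _)]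
    exact Real.exp_le_exp.2 ((le_abs_self _).trans (abs_dotProduct_le_sum_mul_sum v z))

lemma integrable_exp_mul_abs_gaussianReal (C : ℝ) :
    Integrable (fun x => Real.exp (C * |x|)) (gaussianReal 0 1) := by
  refine ((integrable_exp_mul_gaussianReal (μ := 0) (v := 1) C).add
    (integrable_exp_mul_gaussianReal (μ := 0) (v := 1) (-C))).mono'
    (by fun_prop) (Eventually.of_forall fun x => ?_)
  rw [Real.norm_of_nonneg (Real.exp_pos _).le, Pi.add_apply]
  rcases abs_cases x with ⟨h, _⟩ | ⟨h, _⟩ <;> rw [h]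
  · linarith [Real.exp_pos (-C * x)]
  · rw [mul_neg, ← neg_mul]
    linarith [Real.exp_pos (C * x)]

/-- The dominating exponential factors over the coordinates, and each factor has a finite Gaussian
integral. -/
lemma HasExpGrowth.integrable {g : (ι → ℝ) → ℝ} (hg : HasExpGrowth g)
    (hm : AEStronglyMeasurable g (gaussianPi ι)) : Integrable g (gaussianPi ι) := by
  obtain ⟨C, hC, H⟩ := hg
  have hi : Integrable (fun z : ι → ℝ => ∏ i, Real.exp (C * |z i|)) (gaussianPi ι) :=
    Integrable.fintype_prod (f := fun _ x => Real.exp (C * |x|))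
      fun _ => integrable_exp_mul_abs_gaussianReal C
  refine (hi.const_mul C).mono' hm (Eventually.of_forall fun z => ?_)
  rw [← Real.exp_sum, ← Finset.mul_sum]
  exact H z

lemma Continuous.integrable_gaussianPi {g : (ι → ℝ) → ℝ} (hc : Continuous g)
    (hg : HasExpGrowth g) : Integrable g (gaussianPi ι) :=
  hg.integrable hc.aestronglyMeasurable

end GaussianPi

/-! ### Comparison of Gaussian exponential sums -/

section Slepian

variable {ι T : Type*} [Fintype ι] [Fintype T]

/-- The sum `∑ τ, exp ⟨L τ, z⟩`. -/
noncomputable def expSum (L : T → ι → ℝ) (z : ι → ℝ) : ℝ := ∑ τ, Real.exp (L τ ⬝ᵥ z)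

lemma exp_le_expSum (L : T → ι → ℝ) (z : ι → ℝ) (τ : T) :
    Real.exp (L τ ⬝ᵥ z) ≤ expSum L z :=
  Finset.single_le_sum (f := fun τ => Real.exp (L τ ⬝ᵥ z)) (fun _ _ => (Real.exp_pos _).le)
    (Finset.mem_univ τ)

lemma expSum_pos [Nonempty T] (L : T → ι → ℝ) (z : ι → ℝ) : 0 < expSum L z :=
  (Real.exp_pos _).trans_le (exp_le_expSum L z (Classical.arbitrary T))

lemma continuous_expSum (L : T → ι → ℝ) : Continuous (expSum L) := by
  unfold expSum dotProduct
  fun_prop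

lemma continuous_expSum_rpow [Nonempty T] (L : T → ι → ℝ) (q : ℝ) :
    Continuous fun z => expSum L z ^ q :=
  (continuous_expSum L).rpow_const fun z => Or.inl (expSum_pos L z).ne'

lemma rpow_le_one_add {x p : ℝ} (hx : 0 ≤ x) (hp0 : 0 ≤ p) (hp1 : p ≤ 1) : x ^ p ≤ 1 + x := by
  rcases le_total x 1 with h | h
  · linarith [Real.rpow_le_one hx h hp0]
  · have := Real.rpow_le_rpow_of_exponent_le h hp1
    rw [Real.rpow_one] at this
    linarith

lemma hasExpGrowth_expSum (L : T → ι → ℝ) : HasExpGrowth (expSum L) :=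
  HasExpGrowth.sum fun τ _ => hasExpGrowth_exp_dotProduct (L τ)

lemma hasExpGrowth_expSum_rpow [Nonempty T] (L : T → ι → ℝ) {p : ℝ} (hp0 : 0 ≤ p) (hp1 : p ≤ 1) :
    HasExpGrowth (fun z => expSum L z ^ p) :=
  ((HasExpGrowth.const 1).add (hasExpGrowth_expSum L)).of_abs_le fun z => by
    have hS := expSum_pos L z
    rw [abs_of_nonneg (by positivity), abs_of_nonneg (by positivity)]
    exact rpow_le_one_add hS.le hp0 hp1

lemma integrable_expSum_rpow [Nonempty T] (L : T → ι → ℝ) {p : ℝ} (hp0 : 0 ≤ p) (hp1 : p ≤ 1) :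
    Integrable (fun z => expSum L z ^ p) (gaussianPi ι) :=
  (continuous_expSum_rpow L p).integrable_gaussianPi (hasExpGrowth_expSum_rpow L hp0 hp1)

lemma hasDerivAt_sum_exp_rpow [Nonempty T] {x : T → ℝ → ℝ} {x' : T → ℝ} {t : ℝ}
    (hx : ∀ τ, HasDerivAt (x τ) (x' τ) t) (q : ℝ) :
    HasDerivAt (fun s => (∑ τ, Real.exp (x τ s)) ^ q)
      (q * (∑ τ, Real.exp (x τ t)) ^ (q - 1) * ∑ τ, Real.exp (x τ t) * x' τ) t := by
  have hpos : (0 : ℝ) < ∑ τ, Real.exp (x τ t) :=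
    Finset.sum_pos (fun _ _ => Real.exp_pos _) Finset.univ_nonempty
  have h := (HasDerivAt.fun_sum (u := Finset.univ) fun τ _ => (hx τ).exp).rpow_const
    (p := q) (Or.inl hpos.ne')
  exact h.congr_deriv (by ring)

lemma hasDerivAt_dotProduct_line (w z v : ι → ℝ) :
    HasDerivAt (fun t : ℝ => w ⬝ᵥ (z + t • v)) (w ⬝ᵥ v) 0 := by
  have h : (fun t : ℝ => w ⬝ᵥ (z + t • v)) = fun t => w ⬝ᵥ z + t * (w ⬝ᵥ v) := by
    funext t
    rw [dotProduct_add, dotProduct_smul, smul_eq_mul]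
  rw [h]
  exact (((hasDerivAt_id (0 : ℝ)).mul_const (w ⬝ᵥ v)).const_add (w ⬝ᵥ z)).congr_deriv
    (one_mul _)

/-- The directional derivative of the weight `exp ⟨L τ, z⟩ * (expSum L z) ^ (p - 1)`. -/
noncomputable def weightDeriv (L : T → ι → ℝ) (p : ℝ) (τ : T) (v z : ι → ℝ) : ℝ :=
  (L τ ⬝ᵥ v) * (Real.exp (L τ ⬝ᵥ z) * expSum L z ^ (p - 1)) +
    (p - 1) * ∑ σ, (L σ ⬝ᵥ v) *
      (Real.exp (L τ ⬝ᵥ z) * Real.exp (L σ ⬝ᵥ z) * expSum L z ^ (p - 1 - 1))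

lemma hasLineDerivAt_weight [Nonempty T] (L : T → ι → ℝ) (p : ℝ) (τ : T) (v z : ι → ℝ) :
    HasLineDerivAt ℝ (fun z => Real.exp (L τ ⬝ᵥ z) * expSum L z ^ (p - 1))
      (weightDeriv L p τ v z) z v := by
  have h1 := (hasDerivAt_dotProduct_line (L τ) z v).exp
  have h2 := hasDerivAt_sum_exp_rpow (fun σ => hasDerivAt_dotProduct_line (L σ) z v) (p - 1)
  refine (h1.fun_mul h2).congr_deriv ?_
  simp only [zero_smul, add_zero, weightDeriv, expSum]
  rw [Finset.mul_sum, Finset.mul_sum, Finset.mul_sum]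
  congr 1
  · ring
  · exact Finset.sum_congr rfl fun σ _ => by ring

lemma rpow_sub_one_mul_self {x : ℝ} (hx : 0 < x) (q : ℝ) : x ^ (q - 1) * x = x ^ q := by
  rw [Real.rpow_sub_one hx.ne', div_mul_cancel₀ _ hx.ne']

/-- Each exponential is at most the whole sum, so it cancels one negative power and leaves `expSum L
z ^ p`. -/
lemma hasExpGrowth_weight [Nonempty T] (L : T → ι → ℝ) {p : ℝ} (hp0 : 0 ≤ p) (hp1 : p ≤ 1)
    (τ : T) : HasExpGrowth (fun z => Real.exp (L τ ⬝ᵥ z) * expSum L z ^ (p - 1)) :=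
  (hasExpGrowth_expSum_rpow L hp0 hp1).of_abs_le fun z => by
    have hS := expSum_pos L z
    rw [abs_of_nonneg (by positivity), abs_of_nonneg (by positivity),
      ← rpow_sub_one_mul_self hS p, mul_comm]
    exact mul_le_mul_of_nonneg_left (exp_le_expSum L z τ) (by positivity)

lemma hasExpGrowth_weight_mul [Nonempty T] (L : T → ι → ℝ) {p : ℝ} (hp0 : 0 ≤ p) (hp1 : p ≤ 1)
    (τ σ : T) : HasExpGrowth
      (fun z => Real.exp (L τ ⬝ᵥ z) * Real.exp (L σ ⬝ᵥ z) * expSum L z ^ (p - 1 - 1)) :=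
  (hasExpGrowth_weight L hp0 hp1 τ).of_abs_le fun z => by
    have hS := expSum_pos L z
    rw [abs_of_nonneg (by positivity), abs_of_nonneg (by positivity),
      ← rpow_sub_one_mul_self hS (p - 1), mul_assoc, mul_comm (Real.exp (L σ ⬝ᵥ z))]
    gcongr
    exact exp_le_expSum L z σ

lemma continuous_dotProduct_right (v : ι → ℝ) : Continuous fun z : ι → ℝ => v ⬝ᵥ z := by
  unfold dotProduct
  fun_prop

lemma integrable_weightDeriv [Nonempty T] (L : T → ι → ℝ) {p : ℝ} (hp0 : 0 ≤ p) (hp1 : p ≤ 1)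
    (τ : T) (v : ι → ℝ) : Integrable (weightDeriv L p τ v) (gaussianPi ι) := by
  have hc := continuous_dotProduct_right (ι := ι)
  refine Continuous.integrable_gaussianPi ?_ ?_
  · have h1 := continuous_expSum_rpow L (p - 1)
    have h2 := continuous_expSum_rpow L (p - 1 - 1)
    have h3 (σ : T) := hc (L σ)
    unfold weightDeriv
    fun_prop
  · exact ((HasExpGrowth.const _).mul (hasExpGrowth_weight L hp0 hp1 τ)).add
      ((HasExpGrowth.const _).mul (HasExpGrowth.sum fun σ _ =>
        (HasExpGrowth.const _).mul (hasExpGrowth_weight_mul L hp0 hp1 τ σ)))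

/-- The first-order terms give exactly `D * S ^ p`, with `S` the exponential sum. The double sum is
at most `D * S ^ p`, and its factor `p - 1 ≤ 0` turns this upper bound into a lower one; the total
is `(1 + (p - 1)) * D * S ^ p`. -/
lemma le_sum_weightDeriv [Nonempty T] (L M : T → ι → ℝ) {p D : ℝ} (hp1 : p ≤ 1)
    (hdiag : ∀ τ, L τ ⬝ᵥ M τ = D) (hoff : ∀ τ σ, L σ ⬝ᵥ M τ ≤ D) (z : ι → ℝ) :
    p * D * expSum L z ^ p ≤ ∑ τ, weightDeriv L p τ (M τ) z := by
  have hS := expSum_pos L z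
  have h1 : ∑ τ, D * (Real.exp (L τ ⬝ᵥ z) * expSum L z ^ (p - 1)) = D * expSum L z ^ p := by
    rw [← Finset.mul_sum, ← Finset.sum_mul, ← rpow_sub_one_mul_self hS p]
    simp only [expSum]
    ring
  have h2 : ∑ τ, ∑ σ, (L σ ⬝ᵥ M τ) *
      (Real.exp (L τ ⬝ᵥ z) * Real.exp (L σ ⬝ᵥ z) * expSum L z ^ (p - 1 - 1)) ≤
      D * expSum L z ^ p := by
    calc _ ≤ ∑ τ, ∑ σ, D *
          (Real.exp (L τ ⬝ᵥ z) * Real.exp (L σ ⬝ᵥ z) * expSum L z ^ (p - 1 - 1)) := by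
          gcongr with τ _ σ _
          exact hoff τ σ
      _ = D * ((expSum L z * expSum L z) * expSum L z ^ (p - 1 - 1)) := by
          simp only [← Finset.mul_sum, ← Finset.sum_mul]
          simp only [expSum]
      _ = _ := by
          rw [← rpow_sub_one_mul_self hS p, ← rpow_sub_one_mul_self hS (p - 1)]
          ring
  simp only [weightDeriv, hdiag, Finset.sum_add_distrib, h1, ← Finset.mul_sum]
  nlinarith [mul_le_mul_of_nonpos_left h2 (sub_nonpos.2 hp1)]

/-- When `M` is the velocity of a moving family `L`, the right side is the derivative of the `p`-th
moment. Integration by parts in the direction `M τ` replaces each factor `M τ ⬝ᵥ z` by covariances.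
-/
lemma le_integral_expSum_deriv [Nonempty T] (L M : T → ι → ℝ) {p D : ℝ} (hp0 : 0 ≤ p)
    (hp1 : p ≤ 1) (hdiag : ∀ τ, L τ ⬝ᵥ M τ = D) (hoff : ∀ τ σ, L σ ⬝ᵥ M τ ≤ D) :
    p ^ 2 * D * ∫ z, expSum L z ^ p ∂gaussianPi ι ≤
      ∫ z, p * expSum L z ^ (p - 1) * ∑ τ, Real.exp (L τ ⬝ᵥ z) * (M τ ⬝ᵥ z) ∂gaussianPi ι := by
  have hc := continuous_dotProduct_right (ι := ι)
  have hw (τ : T) : Continuous fun z => Real.exp (L τ ⬝ᵥ z) * expSum L z ^ (p - 1) :=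
    (Real.continuous_exp.comp (hc (L τ))).mul (continuous_expSum_rpow L (p - 1))
  have hi (τ : T) : Integrable (fun z => (M τ ⬝ᵥ z) *
      (Real.exp (L τ ⬝ᵥ z) * expSum L z ^ (p - 1))) (gaussianPi ι) :=
    ((hc (M τ)).mul (hw τ)).integrable_gaussianPi
      ((hasExpGrowth_dotProduct (M τ)).mul (hasExpGrowth_weight L hp0 hp1 τ))
  have hstein (τ : T) := integral_dotProduct_mul_gaussianPi
    (fun z => hasLineDerivAt_weight L p τ (M τ) z)
    ((hw τ).integrable_gaussianPi (hasExpGrowth_weight L hp0 hp1 τ))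
    (integrable_weightDeriv L hp0 hp1 τ (M τ)) (hi τ)
  calc p ^ 2 * D * ∫ z, expSum L z ^ p ∂gaussianPi ι
      = p * ∫ z, p * D * expSum L z ^ p ∂gaussianPi ι := by
        rw [integral_const_mul]; ring
    _ ≤ p * ∫ z, ∑ τ, weightDeriv L p τ (M τ) z ∂gaussianPi ι := by
        refine mul_le_mul_of_nonneg_left (integral_mono
          ((integrable_expSum_rpow L hp0 hp1).const_mul _)
          (integrable_finsetSum _ fun τ _ => integrable_weightDeriv L hp0 hp1 τ (M τ))
          fun z => le_sum_weightDeriv L M hp1 hdiag hoff z) hp0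
    _ = _ := by
        rw [integral_finsetSum _ fun τ _ => integrable_weightDeriv L hp0 hp1 τ (M τ)]
        simp only [← hstein]
        rw [← integral_finsetSum _ fun τ _ => hi τ, ← integral_const_mul]
        congr 1 with z
        rw [Finset.mul_sum, Finset.mul_sum]
        exact Finset.sum_congr rfl fun τ _ => by ring

lemma hasDerivAt_integral_expSum_rotation [Nonempty T] (a b : T → ι → ℝ) {p : ℝ} (hp0 : 0 ≤ p)
    (hp1 : p ≤ 1) (θ : ℝ) :
    HasDerivAt
      (fun θ => ∫ z, expSum (fun τ => Real.cos θ • a τ + Real.sin θ • b τ) z ^ p ∂gaussianPi ι)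
      (∫ z, p * expSum (fun τ => Real.cos θ • a τ + Real.sin θ • b τ) z ^ (p - 1) *
        ∑ τ, Real.exp ((Real.cos θ • a τ + Real.sin θ • b τ) ⬝ᵥ z) *
          ((-Real.sin θ • a τ + Real.cos θ • b τ) ⬝ᵥ z) ∂gaussianPi ι) θ := by
  have hc := continuous_dotProduct_right (ι := ι)
  set K : T → ℝ := fun τ => (∑ i, |a τ i|) + ∑ i, |b τ i| with hK
  -- Sines and cosines are at most `1` in absolute value, so one bound dominates the derivative for
  -- all angles at once.
  have hbd (x y : ℝ) (hx : |x| ≤ 1) (hy : |y| ≤ 1) (τ : T) (z : ι → ℝ) :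
      |(x • a τ + y • b τ) ⬝ᵥ z| ≤ K τ * ∑ i, |z i| := by
    rw [add_dotProduct, smul_dotProduct, smul_dotProduct, smul_eq_mul, smul_eq_mul, hK, add_mul]
    refine (abs_add_le _ _).trans (add_le_add ?_ ?_) <;> rw [abs_mul]
    · exact (mul_le_of_le_one_left (abs_nonneg _) hx).trans (abs_dotProduct_le_sum_mul_sum _ _)
    · exact (mul_le_of_le_one_left (abs_nonneg _) hy).trans (abs_dotProduct_le_sum_mul_sum _ _)
  have hline (τ : T) (z : ι → ℝ) (x : ℝ) :
      HasDerivAt (fun θ => (Real.cos θ • a τ + Real.sin θ • b τ) ⬝ᵥ z)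
        ((-Real.sin x • a τ + Real.cos x • b τ) ⬝ᵥ z) x := by
    simp only [add_dotProduct, smul_dotProduct, smul_eq_mul]
    exact ((Real.hasDerivAt_cos x).mul_const _).add ((Real.hasDerivAt_sin x).mul_const _)
  refine (hasDerivAt_integral_of_dominated_loc_of_deriv_le (μ := gaussianPi ι)
    (F := fun θ z => expSum (fun τ => Real.cos θ • a τ + Real.sin θ • b τ) z ^ p)
    (F' := fun θ z => p * expSum (fun τ => Real.cos θ • a τ + Real.sin θ • b τ) z ^ (p - 1) *
        ∑ τ, Real.exp ((Real.cos θ • a τ + Real.sin θ • b τ) ⬝ᵥ z) *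
          ((-Real.sin θ • a τ + Real.cos θ • b τ) ⬝ᵥ z))
    (bound := fun z => p * ((1 + ∑ τ, Real.exp (K τ * ∑ i, |z i|)) *
      ∑ τ, K τ * ∑ i, |z i|)) (s := Set.univ) univ_mem ?_ ?_ ?_ ?_ ?_ ?_).2
  · exact Eventually.of_forall fun x => (continuous_expSum_rpow _ p).aestronglyMeasurable
  · exact integrable_expSum_rpow _ hp0 hp1
  · refine Continuous.aestronglyMeasurable ?_
    have h1 := continuous_expSum_rpow (fun τ => Real.cos θ • a τ + Real.sin θ • b τ) (p - 1)
    refine (continuous_const.mul h1).mul (continuous_finsetSum _ fun τ _ => ?_)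
    exact (Real.continuous_exp.comp (hc _)).mul (hc _)
  · refine Eventually.of_forall fun z x _ => ?_
    set L : T → ι → ℝ := fun τ => Real.cos x • a τ + Real.sin x • b τ with hL
    have hS := expSum_pos L z
    have hs : |(-Real.sin x)| ≤ 1 := by rw [abs_neg]; exact Real.abs_sin_le_one x
    have hKs (τ : T) : 0 ≤ K τ * ∑ i, |z i| :=
      (abs_nonneg _).trans (hbd _ _ hs (Real.abs_cos_le_one x) τ z)
    have hS2 : expSum L z ≤ ∑ τ, Real.exp (K τ * ∑ i, |z i|) :=
      Finset.sum_le_sum fun τ _ => Real.exp_le_exp.2 ((le_abs_self _).trans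
        (hbd _ _ (Real.abs_cos_le_one x) (Real.abs_sin_le_one x) τ z))
    rw [Real.norm_eq_abs, abs_mul, abs_of_nonneg (by positivity), mul_assoc]
    refine mul_le_mul_of_nonneg_left ?_ hp0
    calc _ ≤ expSum L z ^ (p - 1) * (expSum L z * ∑ τ, K τ * ∑ i, |z i|) := by
          gcongr
          rw [Finset.mul_sum]
          refine (Finset.abs_sum_le_sum_abs _ _).trans (Finset.sum_le_sum fun τ _ => ?_)
          rw [abs_mul, abs_of_pos (Real.exp_pos _)]
          exact mul_le_mul (exp_le_expSum L z τ) (hbd _ _ hs (Real.abs_cos_le_one x) τ z)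
            (abs_nonneg _) hS.le
      _ = expSum L z ^ p * ∑ τ, K τ * ∑ i, |z i| := by
          rw [← mul_assoc, rpow_sub_one_mul_self hS]
      _ ≤ _ := by
          refine mul_le_mul_of_nonneg_right ?_ (Finset.sum_nonneg fun τ _ => hKs τ)
          linarith [rpow_le_one_add hS.le hp0 hp1]
  · refine Continuous.integrable_gaussianPi (by fun_prop) ?_
    refine (HasExpGrowth.const p).mul (HasExpGrowth.mul ?_ ?_)
    · exact (HasExpGrowth.const 1).add
        (HasExpGrowth.sum fun τ _ => hasExpGrowth_exp_mul_sum_abs (K τ))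
    · exact HasExpGrowth.sum fun τ _ => (HasExpGrowth.const (K τ)).mul hasExpGrowth_sum_abs
  · exact Eventually.of_forall fun z x _ =>
      hasDerivAt_sum_exp_rpow (fun τ => hline τ z x) p

/-- **Slepian-type comparison.** If the Gaussian processes `⟨a τ, z⟩` and `⟨b τ, z⟩` are independent,
and the covariance of the second minus that of the first is `d` on the diagonal and at most `d` off
it, then the `p`-th moments of the exponential sums, `p ≤ 1`, compare up to `exp (p² d / 2)`. -/
theorem exp_mul_integral_expSum_rpow_le [Nonempty T] (a b : T → ι → ℝ) {p d : ℝ} (hp0 : 0 ≤ p)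
    (hp1 : p ≤ 1) (hab : ∀ τ σ, a τ ⬝ᵥ b σ = 0)
    (hdiag : ∀ τ, b τ ⬝ᵥ b τ - a τ ⬝ᵥ a τ = d)
    (hoff : ∀ τ σ, b σ ⬝ᵥ b τ - a σ ⬝ᵥ a τ ≤ d) :
    Real.exp (p ^ 2 * d / 2) * ∫ z, expSum a z ^ p ∂gaussianPi ι ≤
      ∫ z, expSum b z ^ p ∂gaussianPi ι := by
  set φ : ℝ → ℝ := fun θ =>
    ∫ z, expSum (fun τ => Real.cos θ • a τ + Real.sin θ • b τ) z ^ p ∂gaussianPi ι with hφ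
  -- By orthogonality of the two families, position against velocity leaves only the covariance
  -- difference.
  have hdot (θ : ℝ) (τ σ : T) : (Real.cos θ • a σ + Real.sin θ • b σ) ⬝ᵥ
      (-Real.sin θ • a τ + Real.cos θ • b τ) =
      Real.sin θ * Real.cos θ * (b σ ⬝ᵥ b τ - a σ ⬝ᵥ a τ) := by
    simp only [add_dotProduct, dotProduct_add, smul_dotProduct, dotProduct_smul, smul_eq_mul, hab,
      dotProduct_comm (b σ) (a τ)]
    ring
  have hE (θ : ℝ) : HasDerivAt (fun θ => Real.exp (-(p ^ 2 * d * Real.sin θ ^ 2 / 2)))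
      (Real.exp (-(p ^ 2 * d * Real.sin θ ^ 2 / 2)) *
        -(p ^ 2 * (Real.sin θ * Real.cos θ * d))) θ := by
    refine HasDerivAt.exp ?_
    exact ((((Real.hasDerivAt_sin θ).fun_pow 2).const_mul (p ^ 2 * d)).div_const 2).fun_neg.congr_deriv
      (by push_cast; ring)
  have hψ (θ : ℝ) := (hE θ).fun_mul (hasDerivAt_integral_expSum_rotation a b hp0 hp1 θ)
  -- With `φ' ≥ p² d sin θ cos θ φ`, the integrating factor `exp (-p² d sin² θ / 2)` makes the
  -- product monotone; its endpoint values are the two sides of the claim.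
  have hmono : MonotoneOn
      (fun θ => Real.exp (-(p ^ 2 * d * Real.sin θ ^ 2 / 2)) * φ θ) (Set.Icc 0 (Real.pi / 2)) := by
    refine monotoneOn_of_deriv_nonneg (convex_Icc _ _)
      (fun θ _ => (hψ θ).continuousAt.continuousWithinAt)
      (fun θ _ => (hψ θ).differentiableAt.differentiableWithinAt) fun θ hθ => ?_
    rw [(hψ θ).deriv]
    rw [interior_Icc] at hθ
    have hsc : 0 ≤ Real.sin θ * Real.cos θ := mul_nonneg
      (Real.sin_nonneg_of_nonneg_of_le_pi hθ.1.le (by linarith [hθ.2, Real.pi_pos]))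
      (Real.cos_nonneg_of_neg_pi_div_two_le_of_le (by linarith [hθ.1, Real.pi_pos]) hθ.2.le)
    have hle := le_integral_expSum_deriv (fun τ => Real.cos θ • a τ + Real.sin θ • b τ)
      (fun τ => -Real.sin θ • a τ + Real.cos θ • b τ) (D := Real.sin θ * Real.cos θ * d) hp0 hp1
      (fun τ => by rw [hdot, hdiag])
      (fun τ σ => by rw [hdot]; exact mul_le_mul_of_nonneg_left (hoff τ σ) hsc)
    have := mul_le_mul_of_nonneg_left hle
      (Real.exp_pos (-(p ^ 2 * d * Real.sin θ ^ 2 / 2))).le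
    linarith
  have h := hmono (Set.left_mem_Icc.2 (by positivity)) (Set.right_mem_Icc.2 (by positivity))
    (by positivity)
  simp only [hφ, Real.sin_zero, Real.cos_zero, Real.sin_pi_div_two, Real.cos_pi_div_two, one_smul,
    zero_smul, add_zero, zero_add, one_pow, mul_one] at h
  have h0 : Real.exp (-(p ^ 2 * d * 0 ^ 2 / 2)) = 1 := by simp
  rw [h0, one_mul, Real.exp_neg, inv_mul_eq_div, le_div_iff₀ (Real.exp_pos _), mul_comm] at h
  exact h

end Slepian

/-! ### Exponential moments of the maximum of a Gaussian bilinear form -/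

section OperatorNorm

lemma map_comp_gaussianPi {ι κ : Type*} [Fintype ι] [Fintype κ] {e : κ → ι}
    (he : Function.Injective e) :
    (gaussianPi ι).map (fun z k => z (e k)) = gaussianPi κ := by
  have h := (iIndepFun_pi (μ := fun _ : ι => gaussianReal 0 1) (X := fun _ x => x)
    fun _ => aemeasurable_id).precomp he
  rw [iIndepFun_iff_map_fun_eq_pi_map fun k => (measurable_pi_apply (e k)).aemeasurable] at h
  rw [h]
  congr 1 with k : 1
  exact (measurePreserving_eval (fun _ : ι => gaussianReal 0 1) (e k)).map_eq

lemma integral_exp_sq_gaussianReal {a : ℝ} (ha : a < 1) :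
    ∫ x, Real.exp (a * x ^ 2 / 2) ∂gaussianReal 0 1 = (√(1 - a))⁻¹ := by
  have h1 : 0 < 1 - a := by linarith
  rw [integral_gaussianReal_eq_integral_smul one_ne_zero]
  have h (x : ℝ) : gaussianPDFReal 0 1 x • Real.exp (a * x ^ 2 / 2) =
      (√(2 * Real.pi))⁻¹ * Real.exp (-((1 - a) / 2) * x ^ 2) := by
    rw [gaussianPDFReal, smul_eq_mul, mul_assoc, ← Real.exp_add]
    simp only [NNReal.coe_one, sub_zero, mul_one]
    congr 2
    ring
  simp only [h]
  rw [integral_const_mul, integral_gaussian, ← Real.sqrt_inv, ← Real.sqrt_inv, ← Real.sqrt_mul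
    (by positivity)]
  congr 1
  field_simp

/-- A non-integrable function has integral `0` by convention, contradicting the positive value just
computed. -/
lemma integrable_exp_sq_gaussianReal {a : ℝ} (ha : a < 1) :
    Integrable (fun x => Real.exp (a * x ^ 2 / 2)) (gaussianReal 0 1) := by
  by_contra h
  have h1 := integral_exp_sq_gaussianReal ha
  rw [integral_undef h] at h1
  have : 0 < (√(1 - a))⁻¹ := inv_pos.2 (Real.sqrt_pos.2 (by linarith))
  linarith

variable {T : Type*} [Fintype T] {n : ℕ}

/-- The coefficients of the bilinear form `z ↦ β * ⟨u, z v⟩` on matrices, padded by zero. -/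
def bilinCoeff (β : ℝ) (u v : Fin n → ℝ) : (Fin n × Fin n) ⊕ (Fin n ⊕ Fin n) → ℝ :=
  Sum.elim (fun ij => β * (u ij.1 * v ij.2)) 0

/-- The coefficients of the linear form `(g, h) ↦ β * (⟨u, g⟩ + ⟨v, h⟩)`, padded by zero. -/
def linCoeff (β : ℝ) (u v : Fin n → ℝ) : (Fin n × Fin n) ⊕ (Fin n ⊕ Fin n) → ℝ :=
  Sum.elim 0 (Sum.elim (β • u) (β • v))

lemma bilinCoeff_dotProduct (β : ℝ) (u v : Fin n → ℝ)
    (z : (Fin n × Fin n) ⊕ (Fin n ⊕ Fin n) → ℝ) :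
    bilinCoeff β u v ⬝ᵥ z =
      β * (u ⬝ᵥ (Matrix.of fun i j => z (Sum.inl (i, j))) *ᵥ v) := by
  simp only [dotProduct, bilinCoeff, Fintype.sum_sum_type, Sum.elim_inl, Sum.elim_inr,
    Pi.zero_apply, zero_mul, Finset.sum_const_zero, add_zero, Matrix.mulVec, Matrix.of_apply,
    Fintype.sum_prod_type, Finset.mul_sum]
  exact Finset.sum_congr rfl fun i _ => Finset.sum_congr rfl fun j _ => by ring

lemma linCoeff_dotProduct (β : ℝ) (u v : Fin n → ℝ)
    (z : (Fin n × Fin n) ⊕ (Fin n ⊕ Fin n) → ℝ) :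
    linCoeff β u v ⬝ᵥ z = β * (∑ i, u i * z (Sum.inr (Sum.inl i)) +
      ∑ i, v i * z (Sum.inr (Sum.inr i))) := by
  simp [dotProduct, linCoeff, Fintype.sum_sum_type, Finset.mul_sum, mul_add, mul_assoc]

lemma bilinCoeff_dotProduct_bilinCoeff (β : ℝ) (u v u' v' : Fin n → ℝ) :
    bilinCoeff β u v ⬝ᵥ bilinCoeff β u' v' = β ^ 2 * ((u ⬝ᵥ u') * (v ⬝ᵥ v')) := by
  simp only [dotProduct, bilinCoeff, Fintype.sum_sum_type, Sum.elim_inl, Sum.elim_inr,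
    Pi.zero_apply, zero_mul, Finset.sum_const_zero, add_zero, Fintype.sum_prod_type,
    Finset.mul_sum, Finset.sum_mul]
  rw [Finset.sum_comm]
  exact Finset.sum_congr rfl fun i _ => Finset.sum_congr rfl fun j _ => by ring

lemma linCoeff_dotProduct_linCoeff (β : ℝ) (u v u' v' : Fin n → ℝ) :
    linCoeff β u v ⬝ᵥ linCoeff β u' v' = β ^ 2 * (u ⬝ᵥ u' + v ⬝ᵥ v') := by
  simp only [linCoeff_dotProduct]
  simp only [linCoeff, Sum.elim_inr, Sum.elim_inl, Pi.smul_apply, smul_eq_mul, dotProduct,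
    mul_add, Finset.mul_sum]
  congr 1 <;> exact Finset.sum_congr rfl fun i _ => by ring

/-- The supports are disjoint blocks of coordinates: this is the independence required by the
comparison. -/
lemma bilinCoeff_dotProduct_linCoeff (β : ℝ) (u v u' v' : Fin n → ℝ) :
    bilinCoeff β u v ⬝ᵥ linCoeff β u' v' = 0 := by
  simp [dotProduct, bilinCoeff, linCoeff, Fintype.sum_sum_type]

lemma dotProduct_le_one {u v : Fin n → ℝ} (hu : u ⬝ᵥ u = 1) (hv : v ⬝ᵥ v = 1) :
    u ⬝ᵥ v ≤ 1 := by
  have h : 0 ≤ (u - v) ⬝ᵥ (u - v) := by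
    simp only [dotProduct]
    exact Finset.sum_nonneg fun i _ => mul_self_nonneg _
  simp only [sub_dotProduct, dotProduct_sub, hu, hv, dotProduct_comm v u] at h
  linarith

/-- Completing the square bounds every linear form by the same quadratic expression in the `2n`
Gaussian coordinates, uniformly in `τ`. The sum then costs only a factor `card T`, and the Gaussian
integral factors over the coordinates. -/
lemma integral_expSum_linCoeff_rpow_le [Nonempty T] {u v : T → Fin n → ℝ}
    (hu : ∀ τ, u τ ⬝ᵥ u τ = 1) (hv : ∀ τ, v τ ⬝ᵥ v τ = 1) {l β a : ℝ} (hl : 0 < l) (hβ : l ≤ β)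
    (ha0 : 0 < a) (ha1 : a < 1) :
    ∫ z, expSum (fun τ => linCoeff β (u τ) (v τ)) z ^ (l / β)
        ∂gaussianPi ((Fin n × Fin n) ⊕ (Fin n ⊕ Fin n)) ≤
      (Fintype.card T : ℝ) ^ (l / β) * (Real.exp (l ^ 2 / a) * ((1 - a)⁻¹) ^ n) := by
  have hβ0 : 0 < β := hl.trans_le hβ
  have hq0 : 0 ≤ l / β := by positivity
  have hq1 : l / β ≤ 1 := (div_le_one hβ0).2 hβ
  set f : (Fin n × Fin n) ⊕ (Fin n ⊕ Fin n) → ℝ → ℝ :=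
    Sum.elim (fun _ _ => 1) (fun _ x => Real.exp (a * x ^ 2 / 2)) with hf
  have hfi : Integrable (fun z => ∏ k, f k (z k))
      (gaussianPi ((Fin n × Fin n) ⊕ (Fin n ⊕ Fin n))) := by
    refine Integrable.fintype_prod fun k => ?_
    rcases k with k | k
    · simp [hf]
    · exact integrable_exp_sq_gaussianReal ha1
  have hfv : ∫ z, ∏ k, f k (z k) ∂gaussianPi ((Fin n × Fin n) ⊕ (Fin n ⊕ Fin n)) =
      ((1 - a)⁻¹) ^ n := by
    rw [integral_fintype_prod_eq_prod]
    simp only [hf, Fintype.prod_sum_type, Sum.elim_inl, Sum.elim_inr, integral_const,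
      probReal_univ, smul_eq_mul, mul_one, Finset.prod_const_one, one_mul,
      integral_exp_sq_gaussianReal ha1, Finset.prod_const, Finset.card_univ,
      Fintype.card_sum, Fintype.card_fin]
    rw [pow_add, ← mul_pow, ← mul_inv, Real.mul_self_sqrt (by linarith)]
  have hpt (z : (Fin n × Fin n) ⊕ (Fin n ⊕ Fin n) → ℝ) :
      expSum (fun τ => linCoeff β (u τ) (v τ)) z ^ (l / β) ≤
        (Fintype.card T : ℝ) ^ (l / β) * (Real.exp (l ^ 2 / a) * ∏ k, f k (z k)) := by
    set g : ℝ := ∑ i, z (Sum.inr (Sum.inl i)) ^ 2 with hg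
    set h : ℝ := ∑ i, z (Sum.inr (Sum.inr i)) ^ 2 with hh
    have hfz : ∏ k, f k (z k) = Real.exp (a * (g + h) / 2) := by
      simp only [hf, Fintype.prod_sum_type, Sum.elim_inl, Sum.elim_inr, Finset.prod_const_one,
        one_mul, ← Real.exp_sum, hg, hh]
      congr 1
      simp only [← Finset.sum_div, ← Finset.mul_sum, Fintype.sum_sum_type]
    have hamgm (w y : Fin n → ℝ) (hw : w ⬝ᵥ w = 1) :
        l * ∑ i, w i * y i ≤ a * (∑ i, y i ^ 2) / 2 + l ^ 2 / a / 2 := by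
      have hw' : l ^ 2 / a / 2 = ∑ i, l ^ 2 / a / 2 * (w i * w i) := by
        rw [← Finset.mul_sum, ← dotProduct, hw, mul_one]
      rw [hw', Finset.mul_sum, Finset.mul_sum, Finset.sum_div, ← Finset.sum_add_distrib]
      refine Finset.sum_le_sum fun i _ => ?_
      have h0 : 0 ≤ (a * y i - l * w i) ^ 2 / (2 * a) := by positivity
      have h1 : (a * y i - l * w i) ^ 2 / (2 * a) =
          a * y i ^ 2 / 2 + l ^ 2 / a / 2 * (w i * w i) - l * (w i * y i) := by
        field_simp
        ring
      linarith
    have hterm (τ : T) : linCoeff β (u τ) (v τ) ⬝ᵥ z ≤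
        (a * (g + h) / 2 + l ^ 2 / a) / (l / β) := by
      rw [le_div_iff₀ (by positivity), linCoeff_dotProduct]
      have e : ∀ x : ℝ, β * x * (l / β) = l * x := fun x => by field_simp
      rw [e, mul_add]
      linarith [hamgm _ (fun i => z (Sum.inr (Sum.inl i))) (hu τ),
        hamgm _ (fun i => z (Sum.inr (Sum.inr i))) (hv τ)]
    have hsum : expSum (fun τ => linCoeff β (u τ) (v τ)) z ≤
        Fintype.card T * Real.exp ((a * (g + h) / 2 + l ^ 2 / a) / (l / β)) := by
      refine (Finset.sum_le_sum fun τ _ => Real.exp_le_exp.2 (hterm τ)).trans_eq ?_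
      rw [Finset.sum_const, Finset.card_univ, nsmul_eq_mul]
    refine (Real.rpow_le_rpow (expSum_pos _ z).le hsum hq0).trans_eq ?_
    rw [Real.mul_rpow (by positivity) (Real.exp_pos _).le, ← Real.exp_mul,
      div_mul_cancel₀ _ (by positivity), hfz, ← Real.exp_add, add_comm]
  refine (integral_mono (integrable_expSum_rpow _ hq0 hq1) ((hfi.const_mul _).const_mul _)
    hpt).trans_eq ?_
  rw [integral_const_mul, integral_const_mul, hfv]

/-- The matrix with entries `z (i, j)`. -/
def matrixOf (z : Fin n × Fin n → ℝ) : Matrix (Fin n) (Fin n) ℝ := Matrix.of fun i j => z (i, j)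

/-- Exponential moment bound for the maximum of a Gaussian bilinear form over finitely many pairs
of unit vectors. -/
theorem lintegral_exp_sup_bilin_le [Nonempty T] (hn : 0 < n) {u v : T → Fin n → ℝ}
    (hu : ∀ τ, u τ ⬝ᵥ u τ = 1) (hv : ∀ τ, v τ ⬝ᵥ v τ = 1) {l : ℝ} (hl : 0 < l) :
    ∫⁻ z, ⨆ τ, ENNReal.ofReal (Real.exp (l * (u τ ⬝ᵥ matrixOf z *ᵥ v τ)))
        ∂gaussianPi (Fin n × Fin n) ≤
      ENNReal.ofReal (Real.exp (2 * l * √n + l ^ 2 / 2)) := by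
  have hsn : 0 < √(n : ℝ) := Real.sqrt_pos.2 (by exact_mod_cast hn)
  have hnn : √(n : ℝ) * √n = n := Real.mul_self_sqrt (by positivity)
  -- With `a = s / (1 + s)`, the term `l² / a` equals `l√n + l²` and `(1 - a)⁻ⁿ = (1 + s)ⁿ` is at
  -- most `exp (n s) = exp (l√n)`.
  set s : ℝ := l / √n with hs
  have hs0 : 0 < s := by positivity
  set a : ℝ := s / (1 + s) with ha
  have ha0 : 0 < a := by positivity
  have ha1 : a < 1 := (div_lt_one (by positivity)).2 (by linarith)
  have hnum : Real.exp (l ^ 2 / a) * ((1 - a)⁻¹) ^ n ≤ Real.exp (2 * l * √n + l ^ 2) := by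
    have h1 : (1 - a)⁻¹ = 1 + s := by
      rw [ha]; field_simp; ring
    have h2 : l ^ 2 / a = l * √n + l ^ 2 := by
      rw [ha, hs]; field_simp
    have h3 : (1 + s) ^ n ≤ Real.exp (l * √n) := by
      have : Real.exp (l * √n) = Real.exp s ^ n := by
        rw [← Real.exp_nat_mul, hs]
        congr 1
        field_simp
        rw [sq, hnn]
      rw [this]
      exact pow_le_pow_left₀ (by positivity) (by linarith [Real.add_one_le_exp s]) n
    rw [h1, h2]
    calc _ ≤ Real.exp (l * √n + l ^ 2) * Real.exp (l * √n) := by gcongr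
      _ = _ := by rw [← Real.exp_add]; ring_nf
  have hβ (β : ℝ) (hβ : l ≤ β) :
      ∫⁻ z, ⨆ τ, ENNReal.ofReal (Real.exp (l * (u τ ⬝ᵥ matrixOf z *ᵥ v τ)))
        ∂gaussianPi (Fin n × Fin n) ≤ ENNReal.ofReal
          ((Fintype.card T : ℝ) ^ (l / β) * Real.exp (2 * l * √n + l ^ 2 / 2)) := by
    have hβ0 : 0 < β := hl.trans_le hβ
    have hq0 : 0 ≤ l / β := by positivity
    have hq1 : l / β ≤ 1 := (div_le_one hβ0).2 hβ
    have hsl := exp_mul_integral_expSum_rpow_le (fun τ => bilinCoeff β (u τ) (v τ))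
      (fun τ => linCoeff β (u τ) (v τ)) (d := β ^ 2) hq0 hq1
      (fun τ σ => bilinCoeff_dotProduct_linCoeff _ _ _ _ _)
      (fun τ => by
        rw [bilinCoeff_dotProduct_bilinCoeff, linCoeff_dotProduct_linCoeff, hu, hv]; ring)
      (fun τ σ => by
        rw [bilinCoeff_dotProduct_bilinCoeff, linCoeff_dotProduct_linCoeff]
        have h1 := dotProduct_le_one (hu σ) (hu τ)
        have h2 := dotProduct_le_one (hv σ) (hv τ)
        -- With `x`, `y` the two inner products, this is `x + y - x y = 1 - (1 - x)(1 - y) ≤ 1`.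
        nlinarith [mul_nonneg (sq_nonneg β)
          (mul_nonneg (sub_nonneg.2 h1) (sub_nonneg.2 h2))])
    have hle := hsl.trans (integral_expSum_linCoeff_rpow_le hu hv hl hβ ha0 ha1)
    have hd : (l / β) ^ 2 * β ^ 2 / 2 = l ^ 2 / 2 := by field_simp
    rw [hd] at hle
    have hint : ∫ z, expSum (fun τ => bilinCoeff β (u τ) (v τ)) z ^ (l / β)
        ∂gaussianPi ((Fin n × Fin n) ⊕ (Fin n ⊕ Fin n)) ≤
        (Fintype.card T : ℝ) ^ (l / β) * Real.exp (2 * l * √n + l ^ 2 / 2) := by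
      -- The comparison gains `exp (l² / 2)` on the left, which halves the quadratic term of the
      -- exponent.
      have h1 : Real.exp (2 * l * √n + l ^ 2) =
          Real.exp (l ^ 2 / 2) * Real.exp (2 * l * √n + l ^ 2 / 2) := by
        rw [← Real.exp_add]; ring_nf
      have h2 := hle.trans (mul_le_mul_of_nonneg_left hnum (by positivity))
      rw [h1, mul_left_comm] at h2
      exact le_of_mul_le_mul_left h2 (Real.exp_pos _)
    refine le_trans ?_ (ENNReal.ofReal_le_ofReal hint)
    rw [ofReal_integral_eq_lintegral_ofReal (integrable_expSum_rpow _ hq0 hq1)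
      (Eventually.of_forall fun z => Real.rpow_nonneg (expSum_pos _ z).le _),
      -- The auxiliary coordinates of `g` and `h` are discarded: the bilinear forms see only the
      -- matrix block.
      ← map_comp_gaussianPi (Sum.inl_injective (α := Fin n × Fin n) (β := Fin n ⊕ Fin n)),
      lintegral_map]
    · refine lintegral_mono fun z => iSup_le fun τ => ENNReal.ofReal_le_ofReal ?_
      refine le_trans (le_of_eq ?_) (Real.rpow_le_rpow (Real.exp_pos _).le
        (exp_le_expSum (fun τ => bilinCoeff β (u τ) (v τ)) z τ) hq0)
      rw [← Real.exp_mul, bilinCoeff_dotProduct]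
      congr 1
      simp only [matrixOf]
      field_simp
    · refine Measurable.iSup fun τ => Measurable.ennreal_ofReal (Real.measurable_exp.comp ?_)
      simp only [matrixOf, Matrix.mulVec, dotProduct, Matrix.of_apply]
      fun_prop
    · fun_prop
  -- As `β → ∞` the factor `card T ^ (l / β)` tends to `1`, so the bound no longer depends on the
  -- number of pairs.
  have hlim : Tendsto (fun β : ℝ => ENNReal.ofReal
      ((Fintype.card T : ℝ) ^ (l / β) * Real.exp (2 * l * √n + l ^ 2 / 2))) atTop
      (nhds (ENNReal.ofReal (Real.exp (2 * l * √n + l ^ 2 / 2)))) := by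
    refine ENNReal.tendsto_ofReal ?_
    have h1 : Tendsto (fun β : ℝ => l / β) atTop (nhds 0) := tendsto_const_nhds.div_atTop tendsto_id
    have h2 := (Real.continuousAt_const_rpow (a := (Fintype.card T : ℝ)) (b := 0)
      (by simp)).tendsto.comp h1
    simpa using h2.mul_const (Real.exp (2 * l * √n + l ^ 2 / 2))
  exact ge_of_tendsto hlim (eventually_atTop.2 ⟨l, hβ⟩)

end OperatorNorm

/-! ### From finitely many pairs to the operator norm: tail and mean -/

section OperatorNormMoment

variable {n : ℕ}

lemma vecNorm_two_sq (v : Fin n → ℝ) : vecNorm 2 v ^ 2 = v ⬝ᵥ v := by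
  simp [vecNorm, EuclideanSpace.real_norm_sq_eq, dotProduct, ← sq]

lemma vecNorm_nonneg (p : ℝ≥0∞) [Fact (1 ≤ p)] (v : Fin n → ℝ) : 0 ≤ vecNorm p v := norm_nonneg _

lemma matNorm_nonneg (M : Matrix (Fin n) (Fin n) ℝ) : 0 ≤ matNorm 2 M := norm_nonneg _

lemma continuous_matNorm_matrixOf :
    Continuous fun z : Fin n × Fin n → ℝ => matNorm 2 (matrixOf z) := by
  have h : Continuous fun M : Matrix (Fin n) (Fin n) ℝ =>
      (LinearMap.toContinuousLinearMap (Matrix.toLpLin 2 2 M)) :=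
    LinearMap.continuous_of_finiteDimensional
      ((Matrix.toLpLin 2 2).trans LinearMap.toContinuousLinearMap :
        Matrix (Fin n) (Fin n) ℝ ≃ₗ[ℝ] _).toLinearMap
  exact (h.comp (continuous_matrix fun i j => continuous_apply (i, j))).norm

/-- By homogeneity the bound extends to all vectors; testing `M x` against itself gives `‖M x‖² ≤ t
‖M x‖ ‖x‖`. Nonnegativity of `t` matters when there are no unit vectors. -/
lemma matNorm_two_le {M : Matrix (Fin n) (Fin n) ℝ} {t : ℝ} (ht : 0 ≤ t)
    (h : ∀ u v : Fin n → ℝ, u ⬝ᵥ u = 1 → v ⬝ᵥ v = 1 → u ⬝ᵥ M *ᵥ v ≤ t) : matNorm 2 M ≤ t := by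
  have hbil (u v : Fin n → ℝ) : u ⬝ᵥ M *ᵥ v ≤ t * vecNorm 2 u * vecNorm 2 v := by
    have hzero {w : Fin n → ℝ} (hw : vecNorm 2 w = 0) : w = 0 := by
      have := vecNorm_two_sq w
      rw [hw, zero_pow two_ne_zero] at this
      exact dotProduct_self_eq_zero.1 this.symm
    rcases eq_or_ne (vecNorm 2 u) 0 with hu | hu
    · rw [hzero hu, zero_dotProduct]
      simp [vecNorm]
    rcases eq_or_ne (vecNorm 2 v) 0 with hv | hv
    · rw [hzero hv, Matrix.mulVec_zero, dotProduct_zero]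
      simp [vecNorm]
    have hunit {w : Fin n → ℝ} (hw : vecNorm 2 w ≠ 0) :
        ((vecNorm 2 w)⁻¹ • w) ⬝ᵥ ((vecNorm 2 w)⁻¹ • w) = 1 := by
      rw [smul_dotProduct, dotProduct_smul, smul_eq_mul, smul_eq_mul, ← vecNorm_two_sq]
      field_simp
    have hup := (vecNorm_nonneg 2 u).lt_of_ne' hu
    have hvp := (vecNorm_nonneg 2 v).lt_of_ne' hv
    have := h _ _ (hunit hu) (hunit hv)
    rw [Matrix.mulVec_smul, smul_dotProduct, dotProduct_smul, smul_eq_mul, smul_eq_mul,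
      ← mul_assoc, ← mul_inv, inv_mul_le_iff₀ (by positivity)] at this
    linarith
  refine ContinuousLinearMap.opNorm_le_bound _ ht fun x => ?_
  set y : Fin n → ℝ := M *ᵥ x.ofLp with hy
  have hx : ‖x‖ = vecNorm 2 x.ofLp := rfl
  have hMx : ‖(LinearMap.toContinuousLinearMap (Matrix.toLpLin 2 2 M)) x‖ = vecNorm 2 y := rfl
  rw [hMx, hx]
  have h1 := hbil y x.ofLp
  rw [← hy, ← vecNorm_two_sq] at h1
  rcases (vecNorm_nonneg 2 y).eq_or_lt with h0 | h0
  · rw [← h0]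
    exact mul_nonneg ht (vecNorm_nonneg 2 _)
  · refine le_of_mul_le_mul_left ?_ h0
    linarith

/-- Countably many pairs of unit vectors suffice to compute the operator norm. -/
lemma exists_seq_exp_matNorm_le_iSup (hn : 0 < n) : ∃ u v : ℕ → Fin n → ℝ,
    (∀ k, u k ⬝ᵥ u k = 1) ∧ (∀ k, v k ⬝ᵥ v k = 1) ∧
    ∀ (M : Matrix (Fin n) (Fin n) ℝ) (l : ℝ), 0 < l →
      ENNReal.ofReal (Real.exp (l * matNorm 2 M)) ≤
        ⨆ k, ENNReal.ofReal (Real.exp (l * (u k ⬝ᵥ M *ᵥ v k))) := by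
  let U := {w : (Fin n → ℝ) × (Fin n → ℝ) // w.1 ⬝ᵥ w.1 = 1 ∧ w.2 ⬝ᵥ w.2 = 1}
  let e : Fin n → ℝ := Pi.single ⟨0, hn⟩ 1
  have he : e ⬝ᵥ e = 1 := by simp [e]
  have : Nonempty U := ⟨⟨(e, e), he, he⟩⟩
  refine ⟨fun k => (TopologicalSpace.denseSeq U k).1.1, fun k => (TopologicalSpace.denseSeq U k).1.2,
    fun k => (TopologicalSpace.denseSeq U k).2.1, fun k => (TopologicalSpace.denseSeq U k).2.2,
    fun M l hl => ?_⟩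
  set c := ⨆ k, ENNReal.ofReal (Real.exp (l * ((TopologicalSpace.denseSeq U k).1.1 ⬝ᵥ
    M *ᵥ (TopologicalSpace.denseSeq U k).1.2))) with hc
  rcases eq_or_ne c ⊤ with htop | htop
  · rw [htop]; exact le_top
  have hcont : Continuous fun w : U =>
      ENNReal.ofReal (Real.exp (l * (w.1.1 ⬝ᵥ M *ᵥ w.1.2))) := by
    refine ENNReal.continuous_ofReal.comp (Real.continuous_exp.comp (continuous_const.mul ?_))
    simp only [dotProduct, Matrix.mulVec]
    fun_prop
  have hall (w : U) : ENNReal.ofReal (Real.exp (l * (w.1.1 ⬝ᵥ M *ᵥ w.1.2))) ≤ c := by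
    have hcl : IsClosed {w : U | ENNReal.ofReal (Real.exp (l * (w.1.1 ⬝ᵥ M *ᵥ w.1.2))) ≤ c} :=
      isClosed_le hcont continuous_const
    have hsub : Set.range (TopologicalSpace.denseSeq U) ⊆
        {w : U | ENNReal.ofReal (Real.exp (l * (w.1.1 ⬝ᵥ M *ᵥ w.1.2))) ≤ c} := by
      rintro _ ⟨k, rfl⟩
      exact le_iSup (fun k => ENNReal.ofReal (Real.exp (l * ((TopologicalSpace.denseSeq U k).1.1 ⬝ᵥ
        M *ᵥ (TopologicalSpace.denseSeq U k).1.2)))) k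
    exact closure_minimal hsub hcl (TopologicalSpace.denseRange_denseSeq U w)
  have hcpos : 0 < c.toReal := by
    refine ENNReal.toReal_pos (ne_of_gt ?_) htop
    exact (ENNReal.ofReal_pos.2 (Real.exp_pos _)).trans_le (hall (Classical.arbitrary U))
  have hbd (u v : Fin n → ℝ) (hu : u ⬝ᵥ u = 1) (hv : v ⬝ᵥ v = 1) :
      u ⬝ᵥ M *ᵥ v ≤ Real.log c.toReal / l := by
    have h := (ENNReal.ofReal_le_iff_le_toReal htop).1 (hall ⟨(u, v), hu, hv⟩)
    rw [le_div_iff₀ hl, mul_comm]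
    exact (Real.le_log_iff_exp_le hcpos).2 h
  -- The bound holds for `e` and for `-e` in the first slot, hence for a number and its negative.
  have ht : 0 ≤ Real.log c.toReal / l := by
    have h1 := hbd e e he he
    have h2 := hbd (-e) e (by simpa using he) he
    rw [neg_dotProduct] at h2
    linarith
  have hfin := matNorm_two_le ht hbd
  rw [le_div_iff₀ hl, mul_comm, Real.le_log_iff_exp_le hcpos] at hfin
  exact (ENNReal.ofReal_le_iff_le_toReal htop).2 hfin

/-- The exponential moments of the operator norm of a standard Gaussian matrix. -/
theorem lintegral_exp_matNorm_le (n : ℕ) {l : ℝ} (hl : 0 < l) :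
    ∫⁻ z, ENNReal.ofReal (Real.exp (l * matNorm 2 (matrixOf z))) ∂gaussianPi (Fin n × Fin n) ≤
      ENNReal.ofReal (Real.exp (2 * l * √n + l ^ 2 / 2)) := by
  rcases Nat.eq_zero_or_pos n with rfl | hn
  · have h0 (z : Fin 0 × Fin 0 → ℝ) : matNorm 2 (matrixOf z) = 0 :=
      le_antisymm (matNorm_two_le le_rfl fun u v _ _ => by simp [dotProduct]) (matNorm_nonneg _)
    simp only [h0, mul_zero, Real.exp_zero, ENNReal.ofReal_one, lintegral_const, measure_univ,
      mul_one]
    rw [ENNReal.one_le_ofReal]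
    exact Real.one_le_exp (by positivity)
  obtain ⟨u, v, hu, hv, hM⟩ := exists_seq_exp_matNorm_le_iSup hn
  calc _ ≤ ∫⁻ z, ⨆ N : ℕ, ⨆ k : Fin (N + 1),
        ENNReal.ofReal (Real.exp (l * (u k ⬝ᵥ matrixOf z *ᵥ v k)))
        ∂gaussianPi (Fin n × Fin n) := by
        refine lintegral_mono fun z => (hM _ l hl).trans (iSup_le fun k => ?_)
        exact le_iSup_of_le k (le_iSup (fun j : Fin (k + 1) =>
          ENNReal.ofReal (Real.exp (l * (u j ⬝ᵥ matrixOf z *ᵥ v j)))) (Fin.last k))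
    -- Monotone convergence along the first `N + 1` pairs; the finite bound is uniform in `N`.
    _ = ⨆ N : ℕ, ∫⁻ z, ⨆ k : Fin (N + 1),
        ENNReal.ofReal (Real.exp (l * (u k ⬝ᵥ matrixOf z *ᵥ v k)))
        ∂gaussianPi (Fin n × Fin n) := by
        refine lintegral_iSup (fun N => Measurable.iSup fun k =>
          Measurable.ennreal_ofReal (Real.measurable_exp.comp ?_)) fun N N' hN z => ?_
        · simp only [matrixOf, Matrix.mulVec, dotProduct, Matrix.of_apply]
          fun_prop
        · exact iSup_le fun k => le_iSup (fun j : Fin (N' + 1) =>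
            ENNReal.ofReal (Real.exp (l * (u j ⬝ᵥ matrixOf z *ᵥ v j))))
            (Fin.castLE (by lia) k)
    _ ≤ _ := iSup_le fun N => lintegral_exp_sup_bilin_le (T := Fin (N + 1)) hn
        (fun k => hu k) (fun k => hv k) hl

theorem integrable_exp_matNorm (n : ℕ) {l : ℝ} (hl : 0 < l) :
    Integrable (fun z => Real.exp (l * matNorm 2 (matrixOf z))) (gaussianPi (Fin n × Fin n)) := by
  have hc : Continuous fun z : Fin n × Fin n → ℝ => Real.exp (l * matNorm 2 (matrixOf z)) :=
    Real.continuous_exp.comp (continuous_const.mul continuous_matNorm_matrixOf)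
  refine ⟨hc.aestronglyMeasurable, ?_⟩
  rw [hasFiniteIntegral_iff_ofReal (Eventually.of_forall fun z => (Real.exp_pos _).le)]
  exact (lintegral_exp_matNorm_le n hl).trans_lt ENNReal.ofReal_lt_top

theorem integral_exp_matNorm_le (n : ℕ) {l : ℝ} (hl : 0 < l) :
    ∫ z, Real.exp (l * matNorm 2 (matrixOf z)) ∂gaussianPi (Fin n × Fin n) ≤
      Real.exp (2 * l * √n + l ^ 2 / 2) := by
  rw [← ENNReal.ofReal_le_ofReal_iff (Real.exp_pos _).le, ofReal_integral_eq_lintegral_ofReal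
    (integrable_exp_matNorm n hl) (Eventually.of_forall fun z => (Real.exp_pos _).le)]
  exact lintegral_exp_matNorm_le n hl

/-- The operator norm of a standard Gaussian matrix exceeds `2√n + ε` with probability at most
`exp (-ε² / 2)`. -/
theorem one_sub_exp_le_measureReal_matNorm_le (n : ℕ) {ε : ℝ} (hε : 0 < ε) :
    1 - Real.exp (-ε ^ 2 / 2) ≤
      (gaussianPi (Fin n × Fin n)).real {z | matNorm 2 (matrixOf z) ≤ 2 * √n + ε} := by
  have hmark := measure_ge_le_exp_mul_mgf (μ := gaussianPi (Fin n × Fin n))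
    -- The Chernoff parameter `l = ε` is optimal: it minimizes `l² / 2 - l ε`.
    (X := fun z => matNorm 2 (matrixOf z)) (2 * √n + ε) hε.le (integrable_exp_matNorm n hε)
  have hexp := mul_le_mul_of_nonneg_left (integral_exp_matNorm_le n hε)
    (Real.exp_pos (-ε * (2 * √n + ε))).le
  rw [← Real.exp_add] at hexp
  have hcompl : {z : Fin n × Fin n → ℝ | matNorm 2 (matrixOf z) ≤ 2 * √n + ε}ᶜ ⊆
      {z | 2 * √n + ε ≤ matNorm 2 (matrixOf z)} := by
    intro z hz
    simp only [Set.mem_compl_iff, Set.mem_ofPred_eq, not_le] at hz ⊢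
    exact hz.le
  have hm : MeasurableSet {z : Fin n × Fin n → ℝ | matNorm 2 (matrixOf z) ≤ 2 * √n + ε} :=
    measurableSet_le continuous_matNorm_matrixOf.measurable measurable_const
  have h1 := measureReal_mono (μ := gaussianPi (Fin n × Fin n)) hcompl
  rw [probReal_compl_eq_one_sub hm] at h1
  have h2 : Real.exp (-ε * (2 * √n + ε) + (2 * ε * √n + ε ^ 2 / 2)) =
      Real.exp (-ε ^ 2 / 2) := by congr 1; ring
  rw [h2] at hexp
  have h3 := hmark.trans hexp
  linarith

lemma integrable_matNorm (n : ℕ) :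
    Integrable (fun z => matNorm 2 (matrixOf z)) (gaussianPi (Fin n × Fin n)) := by
  refine (integrable_exp_matNorm n one_pos).mono'
    continuous_matNorm_matrixOf.aestronglyMeasurable (Eventually.of_forall fun z => ?_)
  rw [Real.norm_of_nonneg (matNorm_nonneg _), one_mul]
  linarith [Real.add_one_le_exp (matNorm 2 (matrixOf z))]

/-- Integrate `x ≤ 2√n + exp (x - 2√n)` and use the exponential moment at `l = 1`. -/
lemma integral_matNorm_le (n : ℕ) :
    ∫ z, matNorm 2 (matrixOf z) ∂gaussianPi (Fin n × Fin n) ≤ 2 * √n + Real.exp (1 / 2) := by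
  have hi := integrable_exp_matNorm n one_pos
  have h := integral_mono (integrable_matNorm n)
    ((integrable_const (2 * √n)).add (hi.const_mul (Real.exp (-(2 * √n))))) fun z => by
      simp only [Pi.add_apply]
      rw [← Real.exp_add]
      linarith [Real.add_one_le_exp (-(2 * √n) + 1 * matNorm 2 (matrixOf z))]
  refine h.trans ?_
  rw [integral_add' (integrable_const _) (hi.const_mul _), integral_const, integral_const_mul,
    probReal_univ, one_smul]
  have h2 := mul_le_mul_of_nonneg_left (integral_exp_matNorm_le n one_pos)
    (Real.exp_pos (-(2 * √n))).le
  rw [← Real.exp_add] at h2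
  have h3 : -(2 * √(n : ℝ)) + (2 * 1 * √n + 1 ^ 2 / 2) = 1 / 2 := by ring
  rw [h3] at h2
  linarith

end OperatorNormMoment

/-! ### Second and fourth moments of Gaussian linear forms -/

section Moments

variable {ι : Type*} [Fintype ι]

lemma hasLineDerivAt_dotProduct (w v z : ι → ℝ) :
    HasLineDerivAt ℝ (fun z => w ⬝ᵥ z) (w ⬝ᵥ v) z v := hasDerivAt_dotProduct_line w z v

lemma integrable_dotProduct_pow_mul_pow (l m : ι → ℝ) (j k : ℕ) :
    Integrable (fun z => (l ⬝ᵥ z) ^ j * (m ⬝ᵥ z) ^ k) (gaussianPi ι) :=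
  Continuous.integrable_gaussianPi
    (((continuous_dotProduct_right l).pow j).mul ((continuous_dotProduct_right m).pow k))
    (((hasExpGrowth_dotProduct l).pow j).mul ((hasExpGrowth_dotProduct m).pow k))

lemma integral_dotProduct_mul_dotProduct (l m : ι → ℝ) :
    ∫ z, (l ⬝ᵥ z) * (m ⬝ᵥ z) ∂gaussianPi ι = m ⬝ᵥ l := by
  rw [integral_dotProduct_mul_gaussianPi (g' := fun _ => m ⬝ᵥ l)
    (fun z => hasLineDerivAt_dotProduct m l z)
    (by simpa using integrable_dotProduct_pow_mul_pow l m 0 1) (integrable_const _)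
    (by simpa using integrable_dotProduct_pow_mul_pow l m 1 1)]
  simp

lemma integral_dotProduct_sq (l : ι → ℝ) : ∫ z, (l ⬝ᵥ z) ^ 2 ∂gaussianPi ι = l ⬝ᵥ l := by
  simp only [sq, integral_dotProduct_mul_dotProduct]

/-- One integration by parts, on a single factor `l ⬝ᵥ z`, lowers the degree to two. -/
lemma integral_dotProduct_sq_mul_sq (l m : ι → ℝ) :
    ∫ z, (l ⬝ᵥ z) ^ 2 * (m ⬝ᵥ z) ^ 2 ∂gaussianPi ι =
      (l ⬝ᵥ l) * (m ⬝ᵥ m) + 2 * (m ⬝ᵥ l) ^ 2 := by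
  have hi := integrable_dotProduct_pow_mul_pow l m
  have h02 : Integrable (fun z => (l ⬝ᵥ l) * (m ⬝ᵥ z) ^ 2) (gaussianPi ι) := by
    simpa using (hi 0 2).const_mul (l ⬝ᵥ l)
  have h11 : Integrable (fun z => 2 * (m ⬝ᵥ l) * ((l ⬝ᵥ z) * (m ⬝ᵥ z))) (gaussianPi ι) := by
    simpa using (hi 1 1).const_mul (2 * (m ⬝ᵥ l))
  have hstein := integral_dotProduct_mul_gaussianPi (v := l)
    (g := fun z => (l ⬝ᵥ z) * (m ⬝ᵥ z) ^ 2)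
    (g' := fun z => (l ⬝ᵥ l) * (m ⬝ᵥ z) ^ 2 + 2 * (m ⬝ᵥ l) * ((l ⬝ᵥ z) * (m ⬝ᵥ z)))
    (fun z => ((hasDerivAt_dotProduct_line l z l).fun_mul
      ((hasDerivAt_dotProduct_line m z l).fun_pow 2)).congr_deriv (by
        simp only [zero_smul, add_zero]; push_cast; ring))
    (by simpa using hi 1 2) (h02.add h11)
    ((hi 2 2).congr (Eventually.of_forall fun z => by ring))
  calc _ = ∫ z, (l ⬝ᵥ z) * ((l ⬝ᵥ z) * (m ⬝ᵥ z) ^ 2) ∂gaussianPi ι := by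
        congr 1 with z; ring
    _ = _ := by
        rw [hstein, integral_add h02 h11, integral_const_mul, integral_const_mul,
          integral_dotProduct_sq, integral_dotProduct_mul_dotProduct]
        ring

end Moments

/-! ### Invertibility, gradient and overlap of a Gaussian matrix -/

section GaussianMatrix

variable {n : ℕ}

/-- On every line parallel to the identity matrix the determinant is a value of a monic
characteristic polynomial, so it vanishes at finitely many points. A Fubini argument along these
lines makes the singular matrices Lebesgue-null. -/
lemma ae_isUnit_matrixOf (n : ℕ) :
    ∀ᵐ z ∂gaussianPi (Fin n × Fin n), IsUnit (matrixOf z) := by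
  have hac : gaussianPi (Fin n × Fin n) ≪ volume := by
    rw [gaussianPi_eq_withDensity]
    exact withDensity_absolutelyContinuous _ _
  refine hac.ae_le ?_
  simp only [Matrix.isUnit_iff_isUnit_det, isUnit_iff_ne_zero]
  let e : Fin n × Fin n → ℝ := fun ij => (1 : Matrix (Fin n) (Fin n) ℝ) ij.1 ij.2
  have hdet : Continuous fun z : Fin n × Fin n → ℝ => (matrixOf z).det :=
    Continuous.matrix_det (continuous_matrix fun i j => continuous_apply (i, j))
  refine ae_mem_of_ae_add_linearMap_mem (LinearMap.toSpanSingleton ℝ _ e) volume volume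
    (s := {z | (matrixOf z).det ≠ 0})
    ((isClosed_singleton.preimage hdet).isOpen_compl.measurableSet) fun z => ?_
  have hroots : {t : ℝ | (matrixOf (z + t • e)).det = 0} ⊆
      {t | (-(matrixOf z)).charpoly.IsRoot t} := by
    intro t ht
    have hm : Matrix.scalar (Fin n) t - -(matrixOf z) = matrixOf (z + t • e) := by
      ext i j
      simp [matrixOf, e, Matrix.scalar_apply, Matrix.diagonal_apply, Matrix.one_apply, add_comm]
    rw [Set.mem_ofPred_eq, Polynomial.IsRoot, Matrix.eval_charpoly, hm]
    exact ht
  have hfin := (Polynomial.finite_setOfPred_isRoot (-(matrixOf z)).charpoly_monic.ne_zero).subset hroots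
  have h0 := hfin.measure_zero volume
  rw [← compl_compl {t : ℝ | (matrixOf (z + t • e)).det = 0}] at h0
  exact h0

lemma IsStdGaussianMatrix.hasLaw {Ω : Type*} [MeasurableSpace Ω] {P : Measure Ω}
    {G : Ω → Matrix (Fin n) (Fin n) ℝ} (hG : IsStdGaussianMatrix P G) :
    HasLaw (fun ω (ij : Fin n × Fin n) => G ω ij.1 ij.2) (gaussianPi (Fin n × Fin n)) P :=
  hG.indep.hasLaw_pi fun ij => hG.law ij.1 ij.2

/-- The coefficients of the form `z ↦ (matrixOf z *ᵥ b) i`. -/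
def rowCoeff (b : Fin n → ℝ) (i : Fin n) : Fin n × Fin n → ℝ :=
  fun kj => if kj.1 = i then b kj.2 else 0

/-- The coefficients of the form `z ↦ ((matrixOf z)ᵀ *ᵥ c) i`. -/
def colCoeff (c : Fin n → ℝ) (i : Fin n) : Fin n × Fin n → ℝ :=
  fun kj => if kj.2 = i then c kj.1 else 0

lemma rowCoeff_dotProduct (b : Fin n → ℝ) (i : Fin n) (z : Fin n × Fin n → ℝ) :
    rowCoeff b i ⬝ᵥ z = (matrixOf z *ᵥ b) i := by
  simp [rowCoeff, dotProduct, Fintype.sum_prod_type, matrixOf, Matrix.mulVec, mul_comm]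

lemma colCoeff_dotProduct (c : Fin n → ℝ) (i : Fin n) (z : Fin n × Fin n → ℝ) :
    colCoeff c i ⬝ᵥ z = ((matrixOf z)ᵀ *ᵥ c) i := by
  simp [colCoeff, dotProduct, Fintype.sum_prod_type, matrixOf, Matrix.mulVec, mul_comm]

lemma rowCoeff_dotProduct_self (b : Fin n → ℝ) (i : Fin n) :
    rowCoeff b i ⬝ᵥ rowCoeff b i = b ⬝ᵥ b := by
  simp [rowCoeff, dotProduct, Fintype.sum_prod_type]

lemma colCoeff_dotProduct_self (c : Fin n → ℝ) (i : Fin n) :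
    colCoeff c i ⬝ᵥ colCoeff c i = c ⬝ᵥ c := by
  simp [colCoeff, dotProduct, Fintype.sum_prod_type]

lemma vecNorm_hadamard_sq (b c : Fin n → ℝ) (z : Fin n × Fin n → ℝ) :
    vecNorm 2 ((matrixOf z *ᵥ b) * ((matrixOf z)ᵀ *ᵥ c)) ^ 2 =
      ∑ i, (rowCoeff b i ⬝ᵥ z) ^ 2 * (colCoeff c i ⬝ᵥ z) ^ 2 := by
  rw [vecNorm_two_sq, dotProduct]
  refine Finset.sum_congr rfl fun i _ => ?_
  rw [rowCoeff_dotProduct, colCoeff_dotProduct, Pi.mul_apply]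
  ring

lemma integrable_vecNorm_hadamard_sq (b c : Fin n → ℝ) :
    Integrable (fun z => vecNorm 2 ((matrixOf z *ᵥ b) * ((matrixOf z)ᵀ *ᵥ c)) ^ 2)
      (gaussianPi (Fin n × Fin n)) := by
  simp only [vecNorm_hadamard_sq]
  exact integrable_finsetSum _ fun i _ => integrable_dotProduct_pow_mul_pow _ _ 2 2

/-- Each of the `n` coordinates contributes `‖b‖₂² ‖c‖₂²` plus twice a squared covariance, which is
dropped. -/
lemma le_integral_vecNorm_hadamard_sq (b c : Fin n → ℝ) :
    n * ((b ⬝ᵥ b) * (c ⬝ᵥ c)) ≤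
      ∫ z, vecNorm 2 ((matrixOf z *ᵥ b) * ((matrixOf z)ᵀ *ᵥ c)) ^ 2
        ∂gaussianPi (Fin n × Fin n) := by
  simp only [vecNorm_hadamard_sq]
  rw [integral_finsetSum _ fun i _ => integrable_dotProduct_pow_mul_pow _ _ 2 2]
  simp only [integral_dotProduct_sq_mul_sq, rowCoeff_dotProduct_self, colCoeff_dotProduct_self]
  rw [Finset.sum_add_distrib, Finset.sum_const, Finset.card_univ, Fintype.card_fin, nsmul_eq_mul]
  exact le_add_of_nonneg_right (by positivity)

/-- The coefficients of the form `z ↦ c ⬝ᵥ matrixOf z *ᵥ b`. -/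
def overlapCoeff (b c : Fin n → ℝ) : Fin n × Fin n → ℝ := fun ij => c ij.1 * b ij.2

lemma overlapCoeff_dotProduct (b c : Fin n → ℝ) (z : Fin n × Fin n → ℝ) :
    overlapCoeff b c ⬝ᵥ z = c ⬝ᵥ matrixOf z *ᵥ b := by
  simp only [overlapCoeff, dotProduct, Fintype.sum_prod_type, matrixOf, Matrix.mulVec,
    Matrix.of_apply, Finset.mul_sum]
  exact Finset.sum_congr rfl fun i _ => Finset.sum_congr rfl fun j _ => by ring

lemma integrable_overlap_sq (b c : Fin n → ℝ) :
    Integrable (fun z => |c ⬝ᵥ matrixOf z *ᵥ b| ^ 2) (gaussianPi (Fin n × Fin n)) := by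
  simp only [sq_abs, ← overlapCoeff_dotProduct]
  simpa using integrable_dotProduct_pow_mul_pow (overlapCoeff b c) 0 2 0

lemma integral_overlap_sq (b c : Fin n → ℝ) :
    ∫ z, |c ⬝ᵥ matrixOf z *ᵥ b| ^ 2 ∂gaussianPi (Fin n × Fin n) = (b ⬝ᵥ b) * (c ⬝ᵥ c) := by
  simp only [sq_abs, ← overlapCoeff_dotProduct, integral_dotProduct_sq]
  simp only [overlapCoeff, dotProduct, Fintype.sum_prod_type, Finset.mul_sum, Finset.sum_mul]
  exact Finset.sum_congr rfl fun i _ => Finset.sum_congr rfl fun j _ => by ring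

lemma integrable_overlap (b c : Fin n → ℝ) :
    Integrable (fun z => |c ⬝ᵥ matrixOf z *ᵥ b|) (gaussianPi (Fin n × Fin n)) := by
  simp only [← overlapCoeff_dotProduct]
  exact Integrable.abs (by simpa using integrable_dotProduct_pow_mul_pow (overlapCoeff b c) 0 1 0)

lemma integral_overlap_le (b c : Fin n → ℝ) :
    ∫ z, |c ⬝ᵥ matrixOf z *ᵥ b| ∂gaussianPi (Fin n × Fin n) ≤ 1 + (b ⬝ᵥ b) * (c ⬝ᵥ c) := by
  have h := integral_mono (integrable_overlap b c)
    ((integrable_const (1 : ℝ)).add (integrable_overlap_sq b c)) fun z => by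
      simp only [Pi.add_apply]
      nlinarith [sq_nonneg (|c ⬝ᵥ matrixOf z *ᵥ b| - 1), abs_nonneg (c ⬝ᵥ matrixOf z *ᵥ b)]
  refine h.trans_eq ?_
  rw [integral_add' (integrable_const _) (integrable_overlap_sq b c), integral_overlap_sq]
  simp

lemma vecNorm_infty_sq_le_dotProduct_self (v : Fin n → ℝ) : vecNorm ∞ v ^ 2 ≤ v ⬝ᵥ v := by
  have h : vecNorm ∞ v = ‖v‖ := PiLp.norm_toLp v
  have h0 : 0 ≤ v ⬝ᵥ v := Finset.sum_nonneg fun i _ => mul_self_nonneg (v i)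
  rw [h, ← Real.le_sqrt (norm_nonneg v) h0, pi_norm_le_iff_of_nonneg (Real.sqrt_nonneg _)]
  intro i
  refine Real.abs_le_sqrt ?_
  rw [sq]
  exact Finset.single_le_sum (f := fun i => v i * v i) (fun j _ => mul_self_nonneg (v j))
    (Finset.mem_univ i)

lemma dotProduct_self_le_vecNorm_one_sq (v : Fin n → ℝ) : v ⬝ᵥ v ≤ vecNorm 1 v ^ 2 := by
  have h : vecNorm 1 v = ∑ i, |v i| := by
    simp [vecNorm, PiLp.norm_eq_of_L1]
  have h1 := abs_dotProduct_le_sum_mul_sum v v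
  rw [h, sq]
  exact (le_abs_self _).trans h1

lemma matNorm_one_le (p : ℝ≥0∞) [Fact (1 ≤ p)] :
    matNorm p (1 : Matrix (Fin n) (Fin n) ℝ) ≤ 1 := by
  unfold matNorm
  rw [Matrix.toLpLin_one]
  exact ContinuousLinearMap.norm_id_le

end GaussianMatrix

/-! ### Transfer from the product measure to the probability space -/

section Transfer

variable {Ω : Type*} [MeasurableSpace Ω] {P : Measure Ω} {n : ℕ}
  {G : Ω → Matrix (Fin n) (Fin n) ℝ}

lemma IsStdGaussianMatrix.ae_isUnit (hG : IsStdGaussianMatrix P G) : ∀ᵐ ω ∂P, IsUnit (G ω) := by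
  have h := ae_isUnit_matrixOf n
  rw [← hG.hasLaw.map_eq] at h
  exact ae_of_ae_map hG.hasLaw.aemeasurable h

lemma IsStdGaussianMatrix.ae_inv_inv (hG : IsStdGaussianMatrix P G) :
    ∀ᵐ ω ∂P, (G ω)⁻¹⁻¹ = G ω := by
  filter_upwards [hG.ae_isUnit] with ω hω
  exact Matrix.nonsing_inv_nonsing_inv _ ((Matrix.isUnit_iff_isUnit_det _).1 hω)

lemma IsStdGaussianMatrix.integrable (hG : IsStdGaussianMatrix P G)
    {h : Matrix (Fin n) (Fin n) ℝ → ℝ}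
    (hi : Integrable (fun z => h (matrixOf z)) (gaussianPi (Fin n × Fin n))) :
    Integrable (fun ω => h (G ω)⁻¹⁻¹) P := by
  have hl := hG.hasLaw
  rw [← hl.map_eq] at hi
  refine (hi.comp_aemeasurable hl.aemeasurable).congr ?_
  filter_upwards [hG.ae_inv_inv] with ω hω
  rw [hω]
  rfl

lemma IsStdGaussianMatrix.integral_eq (hG : IsStdGaussianMatrix P G)
    {h : Matrix (Fin n) (Fin n) ℝ → ℝ}
    (hi : Integrable (fun z => h (matrixOf z)) (gaussianPi (Fin n × Fin n))) :
    ∫ ω, h (G ω)⁻¹⁻¹ ∂P = ∫ z, h (matrixOf z) ∂gaussianPi (Fin n × Fin n) := by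
  rw [← hG.hasLaw.integral_comp hi.aestronglyMeasurable]
  refine integral_congr_ae ?_
  filter_upwards [hG.ae_inv_inv] with ω hω
  rw [hω]
  rfl

lemma IsStdGaussianMatrix.one_sub_exp_le [IsProbabilityMeasure P] (hG : IsStdGaussianMatrix P G)
    {ε : ℝ} (hε : 0 < ε) :
    1 - Real.exp (-ε ^ 2 / 2) ≤ P.real {ω | matNorm 2 (G ω)⁻¹⁻¹ ≤ 2 * √n + ε} := by
  refine (one_sub_exp_le_measureReal_matNorm_le n hε).trans_eq ?_
  rw [← hG.hasLaw.measureReal_eq (p := fun z => matNorm 2 (matrixOf z) ≤ 2 * √n + ε)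
    (measurableSet_le continuous_matNorm_matrixOf.measurable measurable_const)]
  refine measureReal_congr ?_
  filter_upwards [hG.ae_inv_inv] with ω hω
  refine propext ?_
  change matNorm 2 (G ω) ≤ 2 * √n + ε ↔ matNorm 2 (G ω)⁻¹⁻¹ ≤ 2 * √n + ε
  rw [hω]

end Transfer

/-! ### Asymptotic bounds and conclusion -/

lemma isBigO_one_of_le {f g : ℕ → ℝ} (h0 : ∀ n, 0 ≤ f n) (hfg : ∀ n, f n ≤ g n)
    (hg : g =O[atTop] fun _ => (1 : ℝ)) : f =O[atTop] fun _ => (1 : ℝ) :=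
  (IsBigO.of_bound 1 (Eventually.of_forall fun n => by
    rw [one_mul, Real.norm_of_nonneg (h0 n)]
    exact (hfg n).trans (le_abs_self _))).trans hg

lemma real_dotProduct_self_nonneg {n : ℕ} (v : Fin n → ℝ) : 0 ≤ v ⬝ᵥ v :=
  Finset.sum_nonneg fun i _ => mul_self_nonneg (v i)

lemma isBigO_dotProduct_self_mul {b c : ∀ n : ℕ, Fin n → ℝ}
    (hb : (fun n => vecNorm 1 (b n)) =O[atTop] fun _ => (1 : ℝ))
    (hc : (fun n => vecNorm 1 (c n)) =O[atTop] fun _ => (1 : ℝ)) :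
    (fun n => (b n ⬝ᵥ b n) * (c n ⬝ᵥ c n)) =O[atTop] fun _ => (1 : ℝ) :=
  isBigO_one_of_le
    (fun n => mul_nonneg (real_dotProduct_self_nonneg _) (real_dotProduct_self_nonneg _))
    (fun n => mul_le_mul (dotProduct_self_le_vecNorm_one_sq (b n))
      (dotProduct_self_le_vecNorm_one_sq (c n)) (real_dotProduct_self_nonneg _) (sq_nonneg _))
    (by simpa using (hb.pow 2).mul (hc.pow 2))

lemma isBigO_natCast_mul_dotProduct_self {b c : ∀ n : ℕ, Fin n → ℝ}
    (hb : (fun _ => (1 : ℝ)) =O[atTop] fun n => vecNorm ∞ (b n))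
    (hc : (fun _ => (1 : ℝ)) =O[atTop] fun n => vecNorm ∞ (c n)) :
    (fun n : ℕ => (n : ℝ)) =O[atTop] fun n => (n : ℝ) * ((b n ⬝ᵥ b n) * (c n ⬝ᵥ c n)) := by
  have h1 : (fun _ => (1 : ℝ)) =O[atTop] fun n => vecNorm ∞ (b n) ^ 2 * vecNorm ∞ (c n) ^ 2 := by
    simpa using (hb.pow 2).mul (hc.pow 2)
  have h2 : (fun n => vecNorm ∞ (b n) ^ 2 * vecNorm ∞ (c n) ^ 2) =O[atTop]
      fun n => (b n ⬝ᵥ b n) * (c n ⬝ᵥ c n) := by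
    refine IsBigO.of_bound 1 (Eventually.of_forall fun n => ?_)
    rw [one_mul, Real.norm_of_nonneg (by positivity)]
    exact (mul_le_mul (vecNorm_infty_sq_le_dotProduct_self (b n))
      (vecNorm_infty_sq_le_dotProduct_self (c n)) (sq_nonneg _)
      (real_dotProduct_self_nonneg _)).trans (le_abs_self _)
  simpa using (isBigO_refl (fun n : ℕ => (n : ℝ)) atTop).mul (h1.trans h2)

lemma isBigO_two_mul_sqrt_add (C : ℝ) :
    (fun n : ℕ => 2 * √(n : ℝ) + C) =O[atTop] fun n : ℕ => (n : ℝ) ^ (1 / 2 : ℝ) := by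
  simp only [← Real.sqrt_eq_rpow]
  refine ((isBigO_refl _ _).const_mul_left 2).add (IsBigO.of_bound |C| ?_)
  filter_upwards [eventually_ge_atTop 1] with n hn
  rw [Real.norm_eq_abs, Real.norm_of_nonneg (Real.sqrt_nonneg _)]
  exact le_mul_of_one_le_right (abs_nonneg C) (Real.one_le_sqrt.2 (by exact_mod_cast hn))

theorem proposition1 {Ω : Type*} [MeasurableSpace Ω] (P : Measure Ω) [IsProbabilityMeasure P]
    (f : ℝ → ℝ) (L : ℝ≥0) (μ : ℝ) (hf : IsAdmissibleCost f L μ)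
    (b c : ∀ n : ℕ, Fin n → ℝ)
    (hb_infty : (fun n => vecNorm ∞ (b n)) =Θ[atTop] fun _ => (1 : ℝ))
    (hb_one : (fun n => vecNorm 1 (b n)) =Θ[atTop] fun _ => (1 : ℝ))
    (hc_infty : (fun n => vecNorm ∞ (c n)) =Θ[atTop] fun _ => (1 : ℝ))
    (hc_one : (fun n => vecNorm 1 (c n)) =Θ[atTop] fun _ => (1 : ℝ))
    (G : ∀ n : ℕ, Ω → Matrix (Fin n) (Fin n) ℝ) (hG : ∀ n, IsStdGaussianMatrix P (G n))
    (F : RandomDesignFamily Ω (fun n => n)) (hF : F = gaussianFamily f b c G) :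
    (∀ n, ∀ᵐ ω ∂P, IsUnit (G n ω)) ∧
    (∀ n : ℕ, ∀ ε : ℝ, 0 < ε →
      1 - 2 * Real.exp (-ε ^ 2 / 2) ≤
        P.real {ω | matNorm 2 (F.A n ω)⁻¹ ≤ 2 * Real.sqrt n + ε}) ∧
    ((∀ n, Integrable (fun ω => vecNorm 2 ((F.sys n ω).gradVec (F.c n)) ^ 2) P) ∧
      (fun n : ℕ => (n : ℝ)) =O[atTop]
        fun n => ∫ ω, vecNorm 2 ((F.sys n ω).gradVec (F.c n)) ^ 2 ∂P) ∧
    ((∀ n, Integrable (fun ω => |(F.sys n ω).overlap (F.c n)| ^ 2) P) ∧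
      (fun n => ∫ ω, |(F.sys n ω).overlap (F.c n)| ^ 2 ∂P) =O[atTop] fun _ => (1 : ℝ)) ∧
    F.ConvergenceConditionsOnAverage P (1 / 2) (1 / 2) := by
  subst hF
  have hgrad (n : ℕ) : (fun ω => vecNorm 2 (((gaussianFamily f b c G).sys n ω).gradVec
      ((gaussianFamily f b c G).c n)) ^ 2) =
      fun ω => vecNorm 2 (((G n ω)⁻¹⁻¹ *ᵥ b n) * (((G n ω)⁻¹⁻¹)ᵀ *ᵥ c n)) ^ 2 := by
    funext ω
    simp [gaussianFamily, RandomDesignFamily.sys, PhysicalSystem.gradVec]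
  have hgrad_int (n : ℕ) := (hG n).integrable
    (h := fun M => vecNorm 2 ((M *ᵥ b n) * (Mᵀ *ᵥ c n)) ^ 2)
    (integrable_vecNorm_hadamard_sq (b n) (c n))
  have hgrad_eq (n : ℕ) := (hG n).integral_eq
    (h := fun M => vecNorm 2 ((M *ᵥ b n) * (Mᵀ *ᵥ c n)) ^ 2)
    (integrable_vecNorm_hadamard_sq (b n) (c n))
  have hgrad_bound : (fun n : ℕ => (n : ℝ)) =O[atTop] fun n =>
      ∫ ω, vecNorm 2 (((G n ω)⁻¹⁻¹ *ᵥ b n) * (((G n ω)⁻¹⁻¹)ᵀ *ᵥ c n)) ^ 2 ∂P := by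
    refine (isBigO_natCast_mul_dotProduct_self hb_infty.2 hc_infty.2).trans
      (IsBigO.of_bound 1 (Eventually.of_forall fun n => ?_))
    rw [one_mul, Real.norm_of_nonneg (mul_nonneg (Nat.cast_nonneg n)
      (mul_nonneg (real_dotProduct_self_nonneg _) (real_dotProduct_self_nonneg _))), hgrad_eq]
    exact (le_integral_vecNorm_hadamard_sq (b n) (c n)).trans (le_abs_self _)
  have hbc := isBigO_dotProduct_self_mul hb_one.1 hc_one.1
  have hB (p : ℝ≥0∞) [Fact (1 ≤ p)] :
      (fun n => matNorm p ((gaussianFamily f b c G).B n)) =O[atTop] fun _ => (1 : ℝ) :=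
    isBigO_one_of_le (fun n => norm_nonneg _) (fun n => matNorm_one_le p) (isBigO_refl _ _)
  refine ⟨fun n => (hG n).ae_isUnit, fun n ε hε => ?_, ⟨fun n => ?_, ?_⟩, ⟨fun n => ?_, ?_⟩, ?_⟩
  -- The bound proved above is stronger: one copy of the exponential suffices instead of two.
  · exact le_trans (by linarith [Real.exp_pos (-ε ^ 2 / 2)]) ((hG n).one_sub_exp_le hε)
  · rw [hgrad]
    exact hgrad_int n
  · simp only [hgrad]
    exact hgrad_bound
  · exact (hG n).integrable (h := fun M => |c n ⬝ᵥ M *ᵥ b n| ^ 2) (integrable_overlap_sq (b n) (c n))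
  · refine isBigO_one_of_le (fun n => integral_nonneg fun ω => sq_nonneg _) (fun n => ?_) hbc
    refine ((hG n).integral_eq (h := fun M => |c n ⬝ᵥ M *ᵥ b n| ^ 2)
      (integrable_overlap_sq (b n) (c n))).le.trans ?_
    exact (integral_overlap_sq (b n) (c n)).le
  · refine
      { cost := ⟨L, μ, hf⟩
        invertible := fun n => ?_
        inv_integrable := fun n => (hG n).integrable (h := matNorm 2) (integrable_matNorm n)
        inv_bound := ?_
        B_infty := hB ∞
        B_one := hB 1
        B_two := hB 2
        b_infty := hb_infty.1
        b_one := hb_one.1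
        c_infty := hc_infty.1
        c_one := hc_one.1
        grad_integrable := fun n => ?_
        grad_bound := ?_
        overlap_integrable := fun n => (hG n).integrable (h := fun M => |c n ⬝ᵥ M *ᵥ b n|)
          (integrable_overlap (b n) (c n))
        overlap_bound := ?_ }
    · filter_upwards [(hG n).ae_isUnit] with ω hω
      exact Matrix.isUnit_nonsing_inv_iff.2 hω
    · refine IsBigO.trans (IsBigO.of_bound 1 (Eventually.of_forall fun n => ?_))
        (isBigO_two_mul_sqrt_add (Real.exp (1 / 2)))
      rw [one_mul, Real.norm_of_nonneg (integral_nonneg fun ω => matNorm_nonneg _)]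
      refine ((hG n).integral_eq (h := matNorm 2) (integrable_matNorm n)).le.trans ?_
      exact (integral_matNorm_le n).trans (le_abs_self _)
    · rw [hgrad]
      exact hgrad_int n
    · simp only [hgrad]
      have h1 : (1 / 2 + 1 / 2 : ℝ) = 1 := by norm_num
      simp only [h1, Real.rpow_one]
      exact hgrad_bound
    · refine isBigO_one_of_le (fun n => integral_nonneg fun ω => abs_nonneg _) (fun n => ?_)
        ((isBigO_refl _ _).add hbc)
      refine ((hG n).integral_eq (h := fun M => |c n ⬝ᵥ M *ᵥ b n|)
        (integrable_overlap (b n) (c n))).le.trans ?_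
      exact integral_overlap_le (b n) (c n)
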